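/- Let $p>1$, $a\le 1$ and $R\ge 1$, and write $\langle x\rangle=(1+x^2)^{1/2}$. Let $f\in C^2(\mathbb R)$ and $g\in C^1(\mathbb R)$ be real-valued with $\operatorname{supp} f,\ \operatorname{supp} g\subset\{x\in\mathbb R: |x|\le R\}$, and assume $$\int_{\mathbb R}(-e^x+e^{-x})f'(x)\,dx\ge 0,\qquad \int_{\mathbb R}(-e^x+e^{-x})\{g'(x)-f'(x)\}\,dx\ge 0,$$ where the second integral is not $0$. For $\varepsilon>0$ consider the Cauchy problem $$u_{tt}-u_{xx}=\frac{|u_x|^p}{\langle x\rangle^a}\ \text{ in }\mathbb R\times(0,T),\qquad u(x,0)=\varepsilon f(x),\quad u_t(x,0)=\varepsilon g(x),\quad x\in\mathbb R .$$ A classical solution on $\mathbb R\times[0,T)$, $T\in(0,\infty]$, is a function $u\in C^2(\mathbb R\times[0,T))$ satisfying these relations, and the lifespan $T(\varepsilon)$ is the supremum of all $T\in(0,\infty]$ for which a classical solution on $\mathbb R\times[0,T)$ exists. Then there exist constants $\varepsilon_1>0$ and $C>0$, depending only on $f,g,p,a,R$ (in particular $C$ is independent of $\varepsilon$), such that for every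 $\varepsilon\in(0,\varepsilon_1]$ there is no classical solution on $\mathbb R\times[0,T)$ for any $T\in(0,\infty]$ with $$T>\begin{cases} C\varepsilon^{-(p-1)/(1-a)} & \text{if } a<1,\\ \exp\left(C\varepsilon^{-(p-1)}\right) & \text{if } a=1;\end{cases}$$ consequently $$T(\varepsilon)\le\begin{cases} C\varepsilon^{-(p-1)/(1-a)} & \text{if } a<1,\\ \exp\left(C\varepsilon^{-(p-1)}\right) & \text{if } a=1.\end{cases}$$ -/

import Mathlib

open Set MeasureTheory
open scoped ENNReal

noncomputable section

namespace SpatialDerivWave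

/-- The bracket `⟨x⟩ = (1 + x²)^{1/2}`. -/
def bracket (x : ℝ) : ℝ := Real.sqrt (1 + x ^ 2)

/-- The time interval `[0, T)` for `T ∈ [0, ∞]`. -/
def timeInterval (T : ℝ≥0∞) : Set ℝ := {t : ℝ | 0 ≤ t ∧ ENNReal.ofReal t < T}

/-- `u = u(x, t)` is a classical solution on `ℝ × [0, T)` of
`u_tt - u_xx = |u_x|^p / ⟨x⟩^a`, `u(x, 0) = ε f(x)`, `u_t(x, 0) = ε g(x)`:
it is of class `C²` on `ℝ × [0, T)` (up to `t = 0`, where time derivatives are one-sided),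
satisfies the equation for `0 < t < T` and takes the initial data.
The values of `u` outside `ℝ × [0, T)` play no role. -/
structure IsClassicalSolution (p a ε : ℝ) (f g : ℝ → ℝ) (T : ℝ≥0∞) (u : ℝ → ℝ → ℝ) :
    Prop where
  lifetime_pos : 0 < T
  contDiffOn : ContDiffOn ℝ 2 (fun z : ℝ × ℝ => u z.1 z.2) (univ ×ˢ timeInterval T)
  wave_eq : ∀ x t : ℝ, 0 < t → ENNReal.ofReal t < T →
    iteratedDeriv 2 (fun s => u x s) t - iteratedDeriv 2 (fun y => u y t) x =
      |deriv (fun y => u y t) x| ^ p / bracket x ^ a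
  init_pos : ∀ x : ℝ, u x 0 = ε * f x
  init_vel : ∀ x : ℝ, HasDerivWithinAt (fun s => u x s) (ε * g x) (Ici 0) 0

/-- The lifespan `T(ε)`: the supremum of all `T ∈ (0, ∞]` such that a classical solution
exists on `ℝ × [0, T)`. -/
def lifespan (p a ε : ℝ) (f g : ℝ → ℝ) : ℝ≥0∞ :=
  sSup {T : ℝ≥0∞ | ∃ u : ℝ → ℝ → ℝ, IsClassicalSolution p a ε f g T u}

/-- The lifespan bound, used for `a ≤ 1` only: `C ε^{-(p-1)/(1-a)}` if `a < 1`,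
and `exp (C ε^{-(p-1)})` if `a = 1`. -/
def lifespanBound (p a C ε : ℝ) : ℝ :=
  if a < 1 then C * ε ^ (-(p - 1) / (1 - a)) else Real.exp (C * ε ^ (-(p - 1)))

end SpatialDerivWave

end

namespace SpatialDerivWave

lemma pos_of_damped_ineq {D W W' : ℝ → ℝ} {t₀ t₁ : ℝ}
    (hD : ∀ t ∈ Ico t₀ t₁, HasDerivAt D (W t - 2 * D t) t)
    (hW : ∀ t ∈ Ico t₀ t₁, HasDerivAt W (W' t) t)
    (hW' : ∀ t ∈ Ico t₀ t₁, 0 ≤ D t → 0 ≤ W' t)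
    (hD₀ : 0 < D t₀) (hW₀ : 0 < W t₀) : ∀ t ∈ Ico t₀ t₁, 0 < D t := by
  intro t ht
  by_contra hneg
  push Not at hneg
  have hDc : ContinuousOn D (Icc t₀ t) := fun x hx =>
    (hD x ⟨hx.1, hx.2.trans_lt ht.2⟩).continuousAt.continuousWithinAt
  have hKc : IsCompact (Icc t₀ t ∩ D ⁻¹' Iic 0) :=
    isCompact_Icc.of_isClosed_subset
      (hDc.preimage_isClosed_of_isClosed isClosed_Icc isClosed_Iic) inter_subset_left
  obtain ⟨s, hs⟩ := hKc.exists_isLeast ⟨t, ⟨ht.1, le_rfl⟩, hneg⟩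
  obtain ⟨⟨hst, hDs⟩, hmin⟩ := hs
  have hsub : Icc t₀ s ⊆ Ico t₀ t₁ := fun x hx => ⟨hx.1, (hx.2.trans hst.2).trans_lt ht.2⟩
  have hpos : ∀ x ∈ Ioo t₀ s, 0 ≤ D x := by
    intro x hx
    by_contra h
    push Not at h
    exact absurd (hmin ⟨⟨hx.1.le, hx.2.le.trans hst.2⟩, h.le⟩) (not_le.2 hx.2)
  have hWmono : MonotoneOn W (Icc t₀ s) := by
    refine monotoneOn_of_deriv_nonneg (convex_Icc _ _)
      (fun x hx => (hW x (hsub hx)).continuousAt.continuousWithinAt)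
      (fun x hx => ?_) (fun x hx => ?_)
    · rw [interior_Icc] at hx
      exact (hW x (hsub (Ioo_subset_Icc_self hx))).differentiableAt.differentiableWithinAt
    · rw [interior_Icc] at hx
      have hx' := hsub (Ioo_subset_Icc_self hx)
      rw [(hW x hx').deriv]
      exact hW' x hx' (hpos x hx)
  have hE : ∀ x ∈ Icc t₀ s, HasDerivAt (fun x => Real.exp (2 * x) * D x)
      (Real.exp (2 * x) * W x) x := by
    intro x hx
    have h1 : HasDerivAt (fun x : ℝ => Real.exp (2 * x)) (Real.exp (2 * x) * 2) x := by
      simpa using ((hasDerivAt_id x).const_mul 2).exp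
    refine (h1.mul (hD x (hsub hx))).congr_deriv ?_
    ring
  have hmono : MonotoneOn (fun x => Real.exp (2 * x) * D x) (Icc t₀ s) := by
    refine monotoneOn_of_deriv_nonneg (convex_Icc _ _)
      (fun x hx => (hE x hx).continuousAt.continuousWithinAt)
      (fun x hx => ?_) (fun x hx => ?_)
    · rw [interior_Icc] at hx
      exact (hE x (Ioo_subset_Icc_self hx)).differentiableAt.differentiableWithinAt
    · rw [interior_Icc] at hx
      have hx' := Ioo_subset_Icc_self hx
      rw [(hE x hx').deriv]
      have := hWmono (left_mem_Icc.2 hst.1) hx' hx'.1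
      have : 0 < W x := hW₀.trans_le this
      positivity
  have h := hmono (left_mem_Icc.2 hst.1) (right_mem_Icc.2 hst.1) hst.1
  have h1 : 0 < Real.exp (2 * t₀) * D t₀ := by positivity
  have h2 : Real.exp (2 * s) * D s ≤ 0 :=
    mul_nonpos_of_nonneg_of_nonpos (Real.exp_pos _).le hDs
  simp only at h
  linarith

/-- A functional `G` with `G' = W - 2 G` and `W' ≥ w |G| ^ p` cannot live on `[t₀, t₁]` if the clock
`σ` runs from `0` to `1` there slowly compared with `w`. The barrier is
`y = ε c₀ (1 - σ) ^ (-m)`, `m = 2 / (p - 1)`. -/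
lemma no_solution_of_clock {p ε I m c₀ t₀ t₁ : ℝ} (hp : 1 < p) (hε : 0 < ε) (hI : 0 < I)
    (hm : m = 2 / (p - 1)) (hc₀ : c₀ = I / (4 * (m + 2))) (ht : t₀ < t₁)
    {w G W W' σ σ₁ σ₂ : ℝ → ℝ}
    (hG : ∀ t ∈ Icc t₀ t₁, HasDerivAt G (W t - 2 * G t) t)
    (hW : ∀ t ∈ Icc t₀ t₁, HasDerivAt W (W' t) t)
    (hW' : ∀ t ∈ Icc t₀ t₁, w t * |G t| ^ p ≤ W' t)
    (hG₀ : ε * I / 4 ≤ G t₀) (hW₀ : ε * I ≤ W t₀)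
    (hσ : ∀ t ∈ Icc t₀ t₁, HasDerivAt σ (σ₁ t) t)
    (hσ₁ : ∀ t ∈ Icc t₀ t₁, HasDerivAt σ₁ (σ₂ t) t)
    (hσ0 : σ t₀ = 0) (hσ1 : σ t₁ = 1) (hσlt : ∀ t ∈ Ico t₀ t₁, 0 ≤ σ t ∧ σ t < 1)
    (hσ₁b : ∀ t ∈ Icc t₀ t₁, 0 ≤ σ₁ t ∧ σ₁ t ≤ 1) (hσ₂ : ∀ t ∈ Icc t₀ t₁, σ₂ t ≤ 0)
    (hw : ∀ t ∈ Icc t₀ t₁, m * (m + 3) * σ₁ t ≤ w t * ε ^ (p - 1) * c₀ ^ (p - 1)) :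
    False := by
  have hp1 : 0 < p - 1 := by linarith
  have hm0 : 0 < m := by rw [hm]; positivity
  have hmp : m * p = m + 2 := by rw [hm]; field_simp; ring
  have hc0 : 0 < c₀ := by rw [hc₀]; positivity
  have hcI : c₀ * (m + 2) = I / 4 := by rw [hc₀]; field_simp
  have hcI8 : c₀ < I / 4 := by nlinarith
  have hsub : Ico t₀ t₁ ⊆ Icc t₀ t₁ := Ico_subset_Icc_self
  set y : ℝ → ℝ := fun t => ε * c₀ * (1 - σ t) ^ (-m) with hy
  set y₁ : ℝ → ℝ := fun t => ε * c₀ * (m * (1 - σ t) ^ (-m - 1) * σ₁ t) with hy₁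
  set y₂ : ℝ → ℝ := fun t => ε * c₀ * (m * (m + 1) * (1 - σ t) ^ (-m - 2) * σ₁ t ^ 2
    + m * (1 - σ t) ^ (-m - 1) * σ₂ t) with hy₂
  have hdy : ∀ t ∈ Ico t₀ t₁, HasDerivAt y (y₁ t) t := by
    intro t h
    have hpos : 0 < 1 - σ t := by linarith [(hσlt t h).2]
    have h1 : HasDerivAt (fun t => 1 - σ t) (-σ₁ t) t := (hσ t (hsub h)).const_sub 1
    have h2 := h1.rpow_const (p := -m) (Or.inl hpos.ne')
    refine (h2.const_mul (ε * c₀)).congr_deriv ?_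
    simp only [hy₁]; ring
  have hdy₁ : ∀ t ∈ Ico t₀ t₁, HasDerivAt y₁ (y₂ t) t := by
    intro t h
    have hpos : 0 < 1 - σ t := by linarith [(hσlt t h).2]
    have h1 : HasDerivAt (fun t => 1 - σ t) (-σ₁ t) t := (hσ t (hsub h)).const_sub 1
    have h2 := h1.rpow_const (p := -m - 1) (Or.inl hpos.ne')
    refine (((h2.const_mul m).mul (hσ₁ t (hsub h))).const_mul (ε * c₀)).congr_deriv ?_
    simp only [hy₂, show -m - 1 - 1 = -m - 2 by ring]; ring
  have hypos : ∀ t ∈ Ico t₀ t₁, 0 < y t := by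
    intro t h
    have hpos : 0 < 1 - σ t := by linarith [(hσlt t h).2]
    simp only [hy]; positivity
  have hyp : ∀ t ∈ Ico t₀ t₁, y₂ t + 2 * y₁ t ≤ w t * y t ^ p := by
    intro t h
    obtain ⟨hs0, hs1⟩ := hσlt t h
    have hpos : 0 < 1 - σ t := by linarith
    obtain ⟨ha, hb⟩ := hσ₁b t (hsub h)
    have hA : 0 < (1 - σ t) ^ (-m - 2) := by positivity
    have hB : 0 < (1 - σ t) ^ (-m - 1) := by positivity
    have hBA : (1 - σ t) ^ (-m - 1) ≤ (1 - σ t) ^ (-m - 2) :=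
      Real.rpow_le_rpow_of_exponent_ge hpos (by linarith) (by linarith)
    have hyp : y t ^ p = ε * c₀ * (ε ^ (p - 1) * c₀ ^ (p - 1)) * (1 - σ t) ^ (-m - 2) := by
      simp only [hy]
      rw [Real.mul_rpow (by positivity) (by positivity), Real.mul_rpow hε.le hc0.le,
        ← Real.rpow_mul hpos.le, show -m * p = -m - 2 by linarith,
        show ε ^ p = ε * ε ^ (p - 1) by
          rw [Real.rpow_sub_one hε.ne']; field_simp,
        show c₀ ^ p = c₀ * c₀ ^ (p - 1) by
          rw [Real.rpow_sub_one hc0.ne']; field_simp]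
      ring
    rw [hyp]
    have h1 : m * (m + 1) * (1 - σ t) ^ (-m - 2) * σ₁ t ^ 2 ≤
        m * (m + 1) * (1 - σ t) ^ (-m - 2) * σ₁ t := by
      gcongr; nlinarith
    have h2 : m * (1 - σ t) ^ (-m - 1) * σ₂ t ≤ 0 :=
      mul_nonpos_of_nonneg_of_nonpos (by positivity) (hσ₂ t (hsub h))
    have h3 : m * (1 - σ t) ^ (-m - 1) * σ₁ t ≤ m * (1 - σ t) ^ (-m - 2) * σ₁ t := by
      gcongr
    have h4 := mul_le_mul_of_nonneg_right (hw t (hsub h)) hA.le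
    calc y₂ t + 2 * y₁ t
        = ε * c₀ * (m * (m + 1) * (1 - σ t) ^ (-m - 2) * σ₁ t ^ 2
          + m * (1 - σ t) ^ (-m - 1) * σ₂ t + 2 * (m * (1 - σ t) ^ (-m - 1) * σ₁ t)) := by
          simp only [hy₁, hy₂]; ring
      _ ≤ ε * c₀ * (w t * ε ^ (p - 1) * c₀ ^ (p - 1) * (1 - σ t) ^ (-m - 2)) := by
          gcongr
          linarith
      _ = _ := by ring
  have hwnn : ∀ t ∈ Ico t₀ t₁, 0 ≤ w t := by
    intro t h
    have h1 := hw t (hsub h)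
    have h2 : 0 ≤ m * (m + 3) * σ₁ t := by
      have := (hσ₁b t (hsub h)).1
      positivity
    have h3 : 0 < ε ^ (p - 1) * c₀ ^ (p - 1) := by positivity
    rw [mul_assoc (w t)] at h1
    exact nonneg_of_mul_nonneg_left (h2.trans h1) h3
  have key := pos_of_damped_ineq (D := fun t => G t - y t)
    (W := fun t => W t - (y₁ t + 2 * y t)) (W' := fun t => W' t - (y₂ t + 2 * y₁ t))
    (t₀ := t₀) (t₁ := t₁) ?_ ?_ ?_ ?_ ?_
  · have hle : ∀ t ∈ Ico t₀ t₁, ε * c₀ ≤ G t * (1 - σ t) ^ m := by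
      intro t h
      have hpos : 0 < 1 - σ t := by linarith [(hσlt t h).2]
      have h1 : y t ≤ G t := by linarith [key t h]
      have h2 : y t * (1 - σ t) ^ m = ε * c₀ := by
        simp only [hy]
        rw [mul_assoc, ← Real.rpow_add hpos]; simp
      rw [← h2]
      gcongr
    have hcont : ContinuousWithinAt (fun t => G t * (1 - σ t) ^ m) (Ico t₀ t₁) t₁ := by
      have hmem : t₁ ∈ Icc t₀ t₁ := right_mem_Icc.2 ht.le
      refine ContinuousAt.continuousWithinAt ?_
      exact (hG t₁ hmem).continuousAt.mul
        ((continuousAt_const.sub (hσ t₁ hmem).continuousAt).rpow_const (Or.inr hm0.le))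
    have hlim := ContinuousWithinAt.closure_le (f := fun _ => ε * c₀)
      (by rw [closure_Ico ht.ne]; exact right_mem_Icc.2 ht.le) continuousWithinAt_const hcont hle
    have : (0 : ℝ) < ε * c₀ := by positivity
    simp only [hσ1, sub_self, Real.zero_rpow hm0.ne', mul_zero] at hlim
    linarith
  · intro t h
    refine ((hG t (hsub h)).sub (hdy t h)).congr_deriv ?_
    ring
  · intro t h
    exact (hW t (hsub h)).sub ((hdy₁ t h).add ((hdy t h).const_mul 2))
  · intro t h hD
    have h1 : y t ^ p ≤ |G t| ^ p := by
      refine Real.rpow_le_rpow (hypos t h).le ?_ (by linarith)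
      exact le_trans (by linarith) (le_abs_self _)
    have h2 := mul_le_mul_of_nonneg_left h1 (hwnn t h)
    have h3 := hW' t (hsub h)
    have h4 := hyp t h
    linarith
  · simp only [hy, hσ0, sub_zero, Real.one_rpow, mul_one]
    nlinarith
  · have hb := (hσ₁b t₀ (left_mem_Icc.2 ht.le)).2
    have h1 : m * σ₁ t₀ ≤ m := by nlinarith
    have h2 : ε * c₀ * (m * σ₁ t₀) ≤ ε * c₀ * m := by gcongr
    simp only [hy, hy₁, hσ0, sub_zero, Real.one_rpow, mul_one]
    have h3 : ε * (c₀ * (m + 2)) = ε * (I / 4) := by rw [hcI]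
    have h4 : 0 < ε * I := by positivity
    nlinarith

lemma functional_lower_bound {A τ : ℝ} (hA : 0 ≤ A) {G W W' : ℝ → ℝ}
    (hGc : ContinuousOn G (Ico 0 τ)) (hWc : ContinuousOn W (Ico 0 τ))
    (hG : ∀ t ∈ Ioo 0 τ, HasDerivAt G (W t - 2 * G t) t)
    (hW : ∀ t ∈ Ioo 0 τ, HasDerivAt W (W' t) t)
    (hW' : ∀ t ∈ Ioo 0 τ, 0 ≤ W' t) (hG₀ : 0 ≤ G 0) (hW₀ : A ≤ W 0) {t : ℝ}
    (ht : 1 ≤ t) (htτ : t < τ) : A ≤ W t ∧ A / 4 ≤ G t := by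
  have h0 : (0 : ℝ) ∈ Ico 0 τ := ⟨le_rfl, by linarith⟩
  have htm : t ∈ Ico 0 τ := ⟨by linarith, htτ⟩
  have hWmono : MonotoneOn W (Ico 0 τ) := by
    refine monotoneOn_of_deriv_nonneg (convex_Ico _ _) hWc (fun x hx => ?_) (fun x hx => ?_)
    · rw [interior_Ico] at hx
      exact (hW x hx).differentiableAt.differentiableWithinAt
    · rw [interior_Ico] at hx
      rw [(hW x hx).deriv]
      exact hW' x hx
  have hWA : ∀ s ∈ Ico 0 τ, A ≤ W s := fun s hs => hW₀.trans (hWmono h0 hs hs.1)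
  have hE : ∀ x ∈ Ioo 0 τ, HasDerivAt (fun x => Real.exp (2 * x) * (G x - A / 2))
      (Real.exp (2 * x) * (W x - A)) x := by
    intro x hx
    have h1 : HasDerivAt (fun x : ℝ => Real.exp (2 * x)) (Real.exp (2 * x) * 2) x := by
      simpa using ((hasDerivAt_id x).const_mul 2).exp
    refine (h1.mul ((hG x hx).sub_const (A / 2))).congr_deriv ?_
    ring
  have hmono : MonotoneOn (fun x => Real.exp (2 * x) * (G x - A / 2)) (Ico 0 τ) := by
    refine monotoneOn_of_deriv_nonneg (convex_Ico _ _)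
      (ContinuousOn.mul (by fun_prop) (hGc.sub continuousOn_const))
      (fun x hx => ?_) (fun x hx => ?_)
    · rw [interior_Ico] at hx
      exact (hE x hx).differentiableAt.differentiableWithinAt
    · rw [interior_Ico] at hx
      rw [(hE x hx).deriv]
      exact mul_nonneg (Real.exp_pos _).le (sub_nonneg.2 (hWA x (Ioo_subset_Ico_self hx)))
  refine ⟨hWA t htm, ?_⟩
  have h := hmono h0 htm htm.1
  simp only [mul_zero, Real.exp_zero, one_mul] at h
  have h3 : (3 : ℝ) ≤ Real.exp (2 * t) := by linarith [Real.add_one_le_exp (2 * t)]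
  by_contra hlt
  push Not at hlt
  nlinarith

lemma one_le_rpow_neg {ε r : ℝ} (hε : 0 < ε) (hε1 : ε ≤ 1) (hr : r ≤ 0) : 1 ≤ ε ^ r :=
  Real.one_le_rpow_of_pos_of_le_one_of_nonpos hε hε1 hr

/-- The differential inequality `G'' + 2 G' ≥ c t ^ (-a) |G| ^ p` with data of size `ε`
fails beyond the lifespan bound. -/
lemma exists_lifespanBound_of_functional {p a c I : ℝ} (hp : 1 < p) (ha : a ≤ 1) (hc : 0 < c)
    (hI : 0 < I) :
    ∃ C : ℝ, 0 < C ∧ ∀ ε : ℝ, 0 < ε → ε ≤ 1 → ∀ τ : ℝ, lifespanBound p a C ε < τ →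
      ∀ G W W' : ℝ → ℝ, ContinuousOn G (Ico 0 τ) → ContinuousOn W (Ico 0 τ) →
      (∀ t ∈ Ioo 0 τ, HasDerivAt G (W t - 2 * G t) t) →
      (∀ t ∈ Ioo 0 τ, HasDerivAt W (W' t) t) →
      (∀ t ∈ Ioo 0 τ, 0 ≤ W' t) →
      (∀ t ∈ Ioo 0 τ, 1 ≤ t → c * t ^ (-a) * |G t| ^ p ≤ W' t) →
      0 ≤ G 0 → ε * I ≤ W 0 → False := by
  obtain ⟨m, hm⟩ : ∃ m, m = 2 / (p - 1) := ⟨_, rfl⟩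
  obtain ⟨c₀, hc₀⟩ : ∃ c₀, c₀ = I / (4 * (m + 2)) := ⟨_, rfl⟩
  have hp1 : 0 < p - 1 := by linarith
  have hm0 : 0 < m := by rw [hm]; positivity
  have hc0 : 0 < c₀ := by rw [hc₀]; positivity
  obtain ⟨κ, hκ⟩ : ∃ κ, κ = c * c₀ ^ (p - 1) := ⟨_, rfl⟩
  have hκ0 : 0 < κ := by rw [hκ]; positivity
  rcases lt_or_eq_of_le ha with ha1 | rfl
  · have h1a : 0 < 1 - a := by linarith
    set B : ℝ := max 1 ((2 * (m * (m + 3)) / κ) ^ (1 / (1 - a))) with hB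
    have hB1 : 1 ≤ B := le_max_left _ _
    have hB0 : 0 < B := by linarith
    have hBp : 2 * (m * (m + 3)) / κ ≤ B ^ (1 - a) := by
      calc 2 * (m * (m + 3)) / κ
          = ((2 * (m * (m + 3)) / κ) ^ (1 / (1 - a))) ^ (1 - a) := by
            rw [← Real.rpow_mul (by positivity), one_div_mul_cancel h1a.ne', Real.rpow_one]
        _ ≤ _ := Real.rpow_le_rpow (by positivity) (le_max_right _ _) h1a.le
    refine ⟨2 * B, by positivity, ?_⟩
    intro ε hε hε1 τ hτ G W W' hGc hWc hG hW hW'0 hW' hG0 hW0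
    rw [lifespanBound, if_pos ha1, mul_assoc] at hτ
    set T₀ : ℝ := B * ε ^ (-(p - 1) / (1 - a)) with hT₀
    have hε' : 1 ≤ ε ^ (-(p - 1) / (1 - a)) :=
      one_le_rpow_neg hε hε1 (div_nonpos_of_nonpos_of_nonneg (by linarith) h1a.le)
    have hT1 : 1 ≤ T₀ := by nlinarith
    have hT0 : 0 < T₀ := by linarith
    have hTp : T₀ ^ (1 - a) * ε ^ (p - 1) = B ^ (1 - a) := by
      rw [hT₀, Real.mul_rpow hB0.le (by positivity), ← Real.rpow_mul hε.le,
        div_mul_cancel₀ _ h1a.ne', mul_assoc, ← Real.rpow_add hε]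
      simp
    have hlow := functional_lower_bound (A := ε * I) (by positivity) hGc hWc hG hW hW'0 hG0 hW0
      hT1 (by linarith)
    have hIoo : ∀ t ∈ Icc T₀ (2 * T₀), t ∈ Ioo 0 τ := fun t ht =>
      ⟨by linarith [ht.1], by linarith [ht.2]⟩
    refine no_solution_of_clock (p := p) (ε := ε) (I := I) (m := m) (c₀ := c₀) (t₀ := T₀)
      (t₁ := 2 * T₀) (w := fun t => c * t ^ (-a)) (G := G) (W := W) (W' := W')
      (σ := fun t => (t - T₀) / T₀) (σ₁ := fun _ => 1 / T₀) (σ₂ := fun _ => 0)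
      hp hε hI hm hc₀ (by linarith)
      (fun t ht => hG t (hIoo t ht)) (fun t ht => hW t (hIoo t ht))
      (fun t ht => hW' t (hIoo t ht) (by linarith [ht.1])) (by linarith [hlow.2]) hlow.1
      (fun t _ => ((hasDerivAt_id t).sub_const T₀).div_const T₀)
      (fun t _ => hasDerivAt_const t _) (by simp) (by field_simp; ring) ?_ ?_ (by simp) ?_
    · intro t ht
      exact ⟨div_nonneg (by linarith [ht.1]) hT0.le, by
        rw [div_lt_one hT0]; linarith [ht.2]⟩
    · intro t _
      exact ⟨by positivity, by rw [div_le_one hT0]; exact hT1⟩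
    · intro t ht
      have ht0 : 0 < t := by linarith [ht.1]
      have h2 : T₀ ^ (-a) / 2 ≤ t ^ (-a) := by
        rcases le_total 0 a with h | h
        · have h1 : (2 * T₀) ^ (-a) ≤ t ^ (-a) :=
            Real.rpow_le_rpow_of_nonpos ht0 ht.2 (by linarith)
          have h3 : (2 : ℝ)⁻¹ ≤ 2 ^ (-a) := by
            rw [← Real.rpow_neg_one]
            exact Real.rpow_le_rpow_of_exponent_le (by norm_num) (by linarith)
          rw [Real.mul_rpow (by norm_num) hT0.le] at h1
          have h4 : 0 < T₀ ^ (-a) := by positivity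
          nlinarith
        · have h1 : T₀ ^ (-a) ≤ t ^ (-a) :=
            Real.rpow_le_rpow hT0.le ht.1 (by linarith)
          have h4 : 0 < T₀ ^ (-a) := by positivity
          linarith
      have h5 : T₀ ^ (-a) * T₀ = T₀ ^ (1 - a) := by
        rw [sub_eq_neg_add, Real.rpow_add hT0, Real.rpow_one]
      have h6 : 2 * (m * (m + 3)) ≤ κ * (T₀ ^ (-a) * T₀ * ε ^ (p - 1)) := by
        rw [h5, hTp]
        rw [div_le_iff₀ hκ0] at hBp
        linarith
      have h7 : m * (m + 3) * (1 / T₀) ≤ κ * (T₀ ^ (-a) / 2 * ε ^ (p - 1)) := by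
        rw [mul_one_div, div_le_iff₀ hT0]
        linarith
      calc m * (m + 3) * (1 / T₀) ≤ κ * (T₀ ^ (-a) / 2 * ε ^ (p - 1)) := h7
        _ ≤ κ * (t ^ (-a) * ε ^ (p - 1)) := by gcongr
        _ = _ := by rw [hκ]; ring
  · set C : ℝ := max 1 (m * (m + 3) / κ) with hC
    have hC1 : 1 ≤ C := le_max_left _ _
    have hCκ : m * (m + 3) ≤ C * κ := by
      rw [← div_le_iff₀ hκ0]; exact le_max_right _ _
    refine ⟨C, by linarith, ?_⟩
    intro ε hε hε1 τ hτ G W W' hGc hWc hG hW hW'0 hW' hG0 hW0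
    rw [lifespanBound, if_neg (lt_irrefl _)] at hτ
    set L : ℝ := C * ε ^ (-(p - 1)) with hL
    have hε' : 1 ≤ ε ^ (-(p - 1)) := one_le_rpow_neg hε hε1 (by linarith)
    have hL1 : 1 ≤ L := by nlinarith
    have hL0 : 0 < L := by linarith
    have hLε : L * ε ^ (p - 1) = C := by
      rw [hL, mul_assoc, ← Real.rpow_add hε]; simp
    have h1e : 1 < Real.exp L := Real.one_lt_exp_iff.2 hL0
    have hlow := functional_lower_bound (A := ε * I) (by positivity) hGc hWc hG hW hW'0 hG0 hW0
      le_rfl (h1e.trans hτ)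
    have hIoo : ∀ t ∈ Icc 1 (Real.exp L), t ∈ Ioo 0 τ := fun t ht =>
      ⟨by linarith [ht.1], by linarith [ht.2]⟩
    refine no_solution_of_clock (p := p) (ε := ε) (I := I) (m := m) (c₀ := c₀) (t₀ := 1)
      (t₁ := Real.exp L) (w := fun t => c * t ^ (-1 : ℝ)) (G := G) (W := W) (W' := W')
      (σ := fun t => Real.log t / L) (σ₁ := fun t => t⁻¹ / L) (σ₂ := fun t => -(t ^ 2)⁻¹ / L)
      hp hε hI hm hc₀ h1e
      (fun t ht => hG t (hIoo t ht)) (fun t ht => hW t (hIoo t ht))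
      (fun t ht => hW' t (hIoo t ht) ht.1) (by linarith [hlow.2]) hlow.1
      (fun t ht => (Real.hasDerivAt_log (hIoo t ht).1.ne').div_const L)
      (fun t ht => (hasDerivAt_inv (hIoo t ht).1.ne').div_const L)
      (by simp) (by simp [hL0.ne']) ?_ ?_ ?_ ?_
    · intro t ht
      refine ⟨div_nonneg (Real.log_nonneg ht.1) hL0.le, ?_⟩
      rw [div_lt_one hL0, Real.log_lt_iff_lt_exp (by linarith [ht.1])]
      exact ht.2
    · intro t ht
      have ht0 : 0 < t := (hIoo t ht).1
      refine ⟨by positivity, ?_⟩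
      rw [div_le_one hL0]
      exact (inv_le_one_of_one_le₀ ht.1).trans hL1
    · intro t ht
      rw [neg_div]
      have : 0 ≤ (t ^ 2)⁻¹ / L := by positivity
      linarith
    · intro t ht
      have ht0 : 0 < t := (hIoo t ht).1
      have h : m * (m + 3) / L ≤ ε ^ (p - 1) * κ := by
        rw [div_le_iff₀ hL0]
        calc m * (m + 3) ≤ C * κ := hCκ
          _ = _ := by rw [← hLε]; ring
      rw [Real.rpow_neg_one]
      calc m * (m + 3) * (t⁻¹ / L) = t⁻¹ * (m * (m + 3) / L) := by ring
        _ ≤ t⁻¹ * (ε ^ (p - 1) * κ) := by gcongr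
        _ = _ := by rw [hκ]; ring

lemma bracket_pos (x : ℝ) : 0 < bracket x := Real.sqrt_pos.2 (by positivity)

lemma one_le_bracket (x : ℝ) : 1 ≤ bracket x :=
  Real.one_le_sqrt.2 (by nlinarith [sq_nonneg x])

lemma continuous_bracket : Continuous bracket := by
  unfold bracket; fun_prop

lemma bracket_abs (x : ℝ) : bracket |x| = bracket x := by
  unfold bracket; rw [sq_abs]

lemma bracket_le_one_add {x : ℝ} (hx : 0 ≤ x) : bracket x ≤ 1 + x := by
  unfold bracket
  exact Real.sqrt_le_iff.2 ⟨by positivity, by nlinarith⟩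

lemma le_bracket (x : ℝ) : x ≤ bracket x :=
  Real.le_sqrt_of_sq_le (by linarith)

lemma bracket_le_two_mul (x y : ℝ) : bracket x ≤ 2 * bracket y * bracket (x - y) := by
  unfold bracket
  have h4 : (2 : ℝ) = Real.sqrt 4 := by
    rw [show (4 : ℝ) = 2 ^ 2 by norm_num, Real.sqrt_sq (by norm_num)]
  rw [h4, ← Real.sqrt_mul (by norm_num), ← Real.sqrt_mul (by positivity)]
  apply Real.sqrt_le_sqrt
  nlinarith [sq_nonneg (x - y - y), sq_nonneg (y * (x - y)), sq_nonneg y, sq_nonneg (x - y)]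

/-- Peetre's inequality for powers of the bracket. -/
lemma bracket_rpow_le (l x y : ℝ) :
    bracket x ^ l ≤ bracket y ^ l * (2 * bracket (y - x)) ^ |l| := by
  have hx := bracket_pos x
  have hy := bracket_pos y
  have hs := bracket_pos (y - x)
  rcases le_total 0 l with h | h
  · rw [abs_of_nonneg h, ← Real.mul_rpow hy.le (by positivity)]
    refine Real.rpow_le_rpow hx.le ?_ h
    have h1 := bracket_le_two_mul x y
    have h2 : bracket (x - y) = bracket (y - x) := by
      rw [← bracket_abs, abs_sub_comm, bracket_abs]
    rw [h2] at h1
    linarith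
  · rw [abs_of_nonpos h, Real.rpow_neg (by positivity), ← Real.inv_rpow (by positivity),
      ← Real.mul_rpow hy.le (by positivity)]
    refine Real.rpow_le_rpow_of_nonpos (by positivity) ?_ h
    have h1 := bracket_le_two_mul y x
    rw [← div_eq_mul_inv, div_le_iff₀ (by positivity)]
    linarith

lemma exp_add_exp_neg_mul_bracket_rpow_le {l r x ρ : ℝ} (hr : r = |l| + 1) (hx : |x| ≤ ρ) :
    (Real.exp x + Real.exp (-x)) * bracket x ^ l ≤
      2 * (4 * r) ^ r * Real.exp (1 / 2) * (bracket ρ ^ l * Real.exp (ρ / 2)) *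
        (Real.exp (x / 2) + Real.exp (-x / 2)) := by
  have hr1 : 1 ≤ r := by rw [hr]; linarith [abs_nonneg l]
  have hs : 0 ≤ ρ - |x| := by linarith
  have hb := bracket_pos ρ
  have h1 : Real.exp x + Real.exp (-x) ≤ 2 * Real.exp |x| := by
    have := Real.exp_le_exp.2 (le_abs_self x)
    have := Real.exp_le_exp.2 (neg_le_abs x)
    linarith
  have h2 : bracket x ^ l ≤ bracket ρ ^ l * ((4 * r) ^ r * Real.exp ((1 + (ρ - |x|)) / 2)) := by
    rw [← bracket_abs x]
    refine (bracket_rpow_le l |x| ρ).trans ?_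
    gcongr
    calc (2 * bracket (ρ - |x|)) ^ |l| ≤ (2 * bracket (ρ - |x|)) ^ r :=
          Real.rpow_le_rpow_of_exponent_le
            (by linarith [one_le_bracket (ρ - |x|)]) (by linarith)
      _ ≤ (4 * r * Real.exp ((1 + (ρ - |x|)) / (2 * r))) ^ r := by
          have hb' := bracket_pos (ρ - |x|)
          refine Real.rpow_le_rpow (by positivity) ?_ (by linarith)
          have h3 := Real.add_one_le_exp ((1 + (ρ - |x|)) / (2 * r))
          have h4 := bracket_le_one_add hs
          have h5 : 4 * r * ((1 + (ρ - |x|)) / (2 * r)) = 2 * (1 + (ρ - |x|)) := by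
            field_simp; ring
          nlinarith
      _ = (4 * r) ^ r * Real.exp ((1 + (ρ - |x|)) / 2) := by
          rw [Real.mul_rpow (by positivity) (by positivity), ← Real.exp_mul]
          congr 2
          field_simp
  have h6 : Real.exp |x| * Real.exp ((1 + (ρ - |x|)) / 2) =
      Real.exp (1 / 2) * Real.exp (ρ / 2) * Real.exp (|x| / 2) := by
    rw [← Real.exp_add, ← Real.exp_add, ← Real.exp_add]
    congr 1; ring
  have h7 : Real.exp (|x| / 2) ≤ Real.exp (x / 2) + Real.exp (-x / 2) := by
    rcases abs_cases x with h | h <;> rw [h.1] <;>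
      linarith [Real.exp_pos (x / 2), Real.exp_pos (-x / 2)]
  calc (Real.exp x + Real.exp (-x)) * bracket x ^ l
      ≤ (2 * Real.exp |x|) *
        (bracket ρ ^ l * ((4 * r) ^ r * Real.exp ((1 + (ρ - |x|)) / 2))) := by
        have := bracket_pos x
        gcongr
    _ = 2 * (4 * r) ^ r * bracket ρ ^ l *
        (Real.exp |x| * Real.exp ((1 + (ρ - |x|)) / 2)) := by ring
    _ = 2 * (4 * r) ^ r * Real.exp (1 / 2) * (bracket ρ ^ l * Real.exp (ρ / 2)) *
        Real.exp (|x| / 2) := by rw [h6]; ring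
    _ ≤ _ := by gcongr

lemma continuous_bracket_rpow (l : ℝ) : Continuous fun x => bracket x ^ l :=
  continuous_bracket.rpow_const fun x => Or.inl (bracket_pos x).ne'

lemma exists_integral_bracket_rpow_le (l : ℝ) :
    ∃ K : ℝ, 0 < K ∧ ∀ ρ : ℝ, 0 ≤ ρ →
      ∫ x in -ρ..ρ, (Real.exp x + Real.exp (-x)) * bracket x ^ l ≤
        K * (Real.exp ρ * bracket ρ ^ l) := by
  obtain ⟨r, hr⟩ : ∃ r, r = |l| + 1 := ⟨_, rfl⟩
  have hr0 : 0 < r := by rw [hr]; positivity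
  refine ⟨4 * (2 * (4 * r) ^ r * Real.exp (1 / 2)), by positivity, fun ρ hρ => ?_⟩
  have hb := bracket_pos ρ
  have hint : ∫ x in -ρ..ρ, (Real.exp (x / 2) + Real.exp (-x / 2)) =
      4 * (Real.exp (ρ / 2) - Real.exp (-ρ / 2)) := by
    have hd : ∀ x ∈ uIcc (-ρ) ρ, HasDerivAt
        (fun x => 2 * Real.exp (x / 2) - 2 * Real.exp (-x / 2))
        (Real.exp (x / 2) + Real.exp (-x / 2)) x := by
      intro x _
      have h1 := ((hasDerivAt_id x).div_const 2).exp.const_mul 2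
      have h2 := ((hasDerivAt_id x).neg.div_const 2).exp.const_mul 2
      refine (h1.sub h2).congr_deriv ?_
      simp only [id, Pi.neg_apply]; ring
    rw [intervalIntegral.integral_eq_sub_of_hasDerivAt hd
      (Continuous.intervalIntegrable (by fun_prop) _ _), neg_neg]
    ring
  calc ∫ x in -ρ..ρ, (Real.exp x + Real.exp (-x)) * bracket x ^ l
      ≤ ∫ x in -ρ..ρ, 2 * (4 * r) ^ r * Real.exp (1 / 2) * (bracket ρ ^ l * Real.exp (ρ / 2)) *
        (Real.exp (x / 2) + Real.exp (-x / 2)) := by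
        refine intervalIntegral.integral_mono_on (by linarith) ?_ ?_ ?_
        · exact Continuous.intervalIntegrable
            (Continuous.mul (by fun_prop) (continuous_bracket_rpow l)) _ _
        · exact Continuous.intervalIntegrable (by fun_prop) _ _
        · intro x hx
          exact exp_add_exp_neg_mul_bracket_rpow_le hr (abs_le.2 hx)
    _ = 2 * (4 * r) ^ r * Real.exp (1 / 2) * (bracket ρ ^ l * Real.exp (ρ / 2)) *
        (4 * (Real.exp (ρ / 2) - Real.exp (-ρ / 2))) := by
        rw [intervalIntegral.integral_const_mul, hint]
    _ ≤ 2 * (4 * r) ^ r * Real.exp (1 / 2) * (bracket ρ ^ l * Real.exp (ρ / 2)) *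
        (4 * Real.exp (ρ / 2)) := by
        gcongr
        linarith [Real.exp_pos (-ρ / 2)]
    _ = 4 * (2 * (4 * r) ^ r * Real.exp (1 / 2)) *
        (Real.exp (ρ / 2) * Real.exp (ρ / 2) * bracket ρ ^ l) := by ring
    _ = _ := by rw [← Real.exp_add, add_halves]

lemma mul_rpow_sub_one_le {p r s : ℝ} (hp : 1 < p) (hr : 0 ≤ r) (hs : 0 ≤ s) :
    r * s ^ (p - 1) ≤ r ^ p / p + s ^ p * (1 - 1 / p) := by
  have hp1 : 0 < p - 1 := by linarith
  have hpq : p.HolderConjugate (p / (p - 1)) := Real.HolderConjugate.conjExponent hp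
  have h := Real.young_inequality_of_nonneg hr (Real.rpow_nonneg hs (p - 1)) hpq
  rw [← Real.rpow_mul hs, mul_div_cancel₀ _ hp1.ne'] at h
  refine h.trans (le_of_eq ?_)
  field_simp

lemma exists_weighted_lower_bound {p : ℝ} (a : ℝ) (hp : 1 < p) :
    ∃ c : ℝ, 0 < c ∧ ∀ ρ : ℝ, 0 ≤ ρ → ∀ w : ℝ → ℝ, Continuous w →
      c * bracket ρ ^ (-a) * Real.exp (-(p - 1) * ρ) *
        |∫ x in -ρ..ρ, (-Real.exp x + Real.exp (-x)) * w x| ^ p ≤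
      ∫ x in -ρ..ρ, |w x| ^ p / bracket x ^ a * (Real.exp x + Real.exp (-x)) := by
  have hp1 : 0 < p - 1 := by linarith
  obtain ⟨l, hl⟩ : ∃ l, l = a / (p - 1) := ⟨_, rfl⟩
  have hla : l * (p - 1) = a := by rw [hl]; field_simp
  obtain ⟨K, hK, hKb⟩ := exists_integral_bracket_rpow_le l
  refine ⟨K ^ (-(p - 1)), by positivity, fun ρ hρ w hw => ?_⟩
  have hb := bracket_pos ρ
  obtain ⟨Q, hQ⟩ : ∃ Q, Q = K * (Real.exp ρ * bracket ρ ^ l) := ⟨_, rfl⟩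
  have hQ0 : 0 < Q := by rw [hQ]; positivity
  have hQb := hKb ρ hρ
  rw [← hQ] at hQb
  obtain ⟨X, hX⟩ : ∃ X, X = |∫ x in -ρ..ρ, (-Real.exp x + Real.exp (-x)) * w x| := ⟨_, rfl⟩
  have hX0 : 0 ≤ X := by rw [hX]; positivity
  rw [← hX]
  set s := X / Q with hs
  have hs0 : 0 ≤ s := by positivity
  have hXle : X ≤ ∫ x in -ρ..ρ, |w x| * (Real.exp x + Real.exp (-x)) := by
    rw [hX]
    refine (intervalIntegral.abs_integral_le_integral_abs (by linarith)).trans ?_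
    refine intervalIntegral.integral_mono_on (by linarith) ?_ ?_ ?_
    · exact Continuous.intervalIntegrable (by fun_prop) _ _
    · exact Continuous.intervalIntegrable (by fun_prop) _ _
    · intro x _
      rw [abs_mul, mul_comm]
      gcongr
      rw [abs_le]
      constructor <;> linarith [Real.exp_pos x, Real.exp_pos (-x)]
  have hNc : Continuous fun x => |w x| ^ p / bracket x ^ a * (Real.exp x + Real.exp (-x)) := by
    refine Continuous.mul (Continuous.div (hw.abs.rpow_const fun x => Or.inr (by linarith))
      (continuous_bracket_rpow a) fun x => ?_) (by fun_prop)
    have := bracket_pos x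
    positivity
  have hQc : Continuous fun x => (Real.exp x + Real.exp (-x)) * bracket x ^ l :=
    Continuous.mul (by fun_prop) (continuous_bracket_rpow l)
  have hkey : s ^ (p - 1) * ∫ x in -ρ..ρ, |w x| * (Real.exp x + Real.exp (-x)) ≤
      1 / p * (∫ x in -ρ..ρ, |w x| ^ p / bracket x ^ a * (Real.exp x + Real.exp (-x))) +
      s ^ p * (1 - 1 / p) *
        ∫ x in -ρ..ρ, (Real.exp x + Real.exp (-x)) * bracket x ^ l := by
    rw [← intervalIntegral.integral_const_mul, ← intervalIntegral.integral_const_mul,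
      ← intervalIntegral.integral_const_mul, ← intervalIntegral.integral_add
        ((hNc.const_mul _).intervalIntegrable _ _) ((hQc.const_mul _).intervalIntegrable _ _)]
    refine intervalIntegral.integral_mono_on (by linarith) ?_ ?_ ?_
    · exact Continuous.intervalIntegrable (by fun_prop) _ _
    · exact ((hNc.const_mul _).add (hQc.const_mul _)).intervalIntegrable _ _
    · intro x _
      have hbx := bracket_pos x
      have hbl : 0 < bracket x ^ l := by positivity
      have hy := mul_rpow_sub_one_le (r := |w x| / bracket x ^ l) hp (by positivity) hs0
      have h1 : (|w x| / bracket x ^ l) ^ p * bracket x ^ l = |w x| ^ p / bracket x ^ a := by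
        rw [Real.div_rpow (abs_nonneg _) hbl.le, ← hla, Real.rpow_mul hbx.le,
          Real.rpow_sub_one hbl.ne']
        have : 0 < (bracket x ^ l) ^ p := by positivity
        field_simp
      have hm : 0 ≤ bracket x ^ l * (Real.exp x + Real.exp (-x)) := by positivity
      have h2 := mul_le_mul_of_nonneg_right hy hm
      rw [← h1]
      calc s ^ (p - 1) * (|w x| * (Real.exp x + Real.exp (-x)))
          = |w x| / bracket x ^ l * s ^ (p - 1) *
            (bracket x ^ l * (Real.exp x + Real.exp (-x))) := by field_simp
        _ ≤ _ := h2
        _ = _ := by ring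
  obtain ⟨N, hN⟩ : ∃ N, N = ∫ x in -ρ..ρ, |w x| ^ p / bracket x ^ a *
    (Real.exp x + Real.exp (-x)) := ⟨_, rfl⟩
  rw [← hN] at hkey ⊢
  have hp1p : 0 ≤ 1 - 1 / p := by
    rw [sub_nonneg, div_le_one (by linarith)]; linarith
  have h1 : s ^ (p - 1) * X ≤ 1 / p * N + s ^ p * (1 - 1 / p) * Q := by
    refine le_trans (by gcongr) (hkey.trans ?_)
    gcongr
  have hsX : s ^ (p - 1) * X = s ^ p * Q := by
    rcases hs0.eq_or_lt with h | h
    · have hX' : X = 0 := by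
        rcases div_eq_zero_iff.1 (hs.symm.trans h.symm) with h' | h'
        · exact h'
        · exact absurd h' hQ0.ne'
      rw [← h, Real.zero_rpow (by linarith : p ≠ 0), hX']; simp
    · rw [Real.rpow_sub_one h.ne', hs]
      have : X ≠ 0 := by
        intro h0; rw [hs, h0, zero_div] at h; exact lt_irrefl _ h
      field_simp
  rw [hsX] at h1
  have h2 : s ^ p * Q ≤ N := by
    have h3 : 1 / p * (s ^ p * Q) ≤ 1 / p * N := by linarith
    exact le_of_mul_le_mul_left h3 (by positivity)
  refine le_trans (le_of_eq ?_) h2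
  have hQp : Q ^ (-(p - 1)) =
      K ^ (-(p - 1)) * (Real.exp (-(p - 1) * ρ) * bracket ρ ^ (-a)) := by
    rw [hQ, Real.mul_rpow hK.le (by positivity), Real.mul_rpow (by positivity) (by positivity),
      ← Real.exp_mul, ← Real.rpow_mul hb.le]
    rw [mul_comm ρ, show l * -(p - 1) = -a by rw [← hla]; ring]
  rw [hs, Real.div_rpow hX0 hQ0.le]
  have hQp' : Q ^ (-(p - 1)) = Q / Q ^ p := by
    rw [neg_sub, Real.rpow_sub hQ0, Real.rpow_one]
  rw [show X ^ p / Q ^ p * Q = X ^ p * (Q / Q ^ p) by ring, ← hQp', hQp]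
  ring

/-- First derivatives `v = u_t`, `w = u_x` and second derivatives `A = u_tt`, `B = u_tx`,
`E = u_xx` of a solution of the equation on `ℝ × [0, τ]`. -/
structure IsSolutionJet (p a τ : ℝ) (u : ℝ → ℝ → ℝ) (v w A B E : ℝ × ℝ → ℝ) : Prop where
  cont_u : ContinuousOn (fun z : ℝ × ℝ => u z.1 z.2) (univ ×ˢ Icc 0 τ)
  cont_v : ContinuousOn v (univ ×ˢ Icc 0 τ)
  cont_w : ContinuousOn w (univ ×ˢ Icc 0 τ)
  cont_A : ContinuousOn A (univ ×ˢ Ioo 0 τ)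
  cont_E : ContinuousOn E (univ ×ˢ Ioo 0 τ)
  deriv_t : ∀ x, ∀ t ∈ Icc 0 τ, HasDerivWithinAt (fun s => u x s) (v (x, t)) (Icc 0 τ) t
  deriv_x : ∀ x, ∀ t ∈ Icc 0 τ, HasDerivAt (fun y => u y t) (w (x, t)) x
  fderiv_v : ∀ x, ∀ t ∈ Ioo 0 τ, HasFDerivAt v
    (B (x, t) • ContinuousLinearMap.fst ℝ ℝ ℝ + A (x, t) • ContinuousLinearMap.snd ℝ ℝ ℝ) (x, t)
  fderiv_w : ∀ x, ∀ t ∈ Ioo 0 τ, HasFDerivAt w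
    (E (x, t) • ContinuousLinearMap.fst ℝ ℝ ℝ + B (x, t) • ContinuousLinearMap.snd ℝ ℝ ℝ) (x, t)
  wave_eq : ∀ x, ∀ t ∈ Ioo 0 τ, A (x, t) - E (x, t) = |w (x, t)| ^ p / bracket x ^ a

lemma clm_prod_eq (L : ℝ × ℝ →L[ℝ] ℝ) :
    L = L (1, 0) • ContinuousLinearMap.fst ℝ ℝ ℝ + L (0, 1) • ContinuousLinearMap.snd ℝ ℝ ℝ := by
  ext <;> simp

lemma hasDerivAt_prodMk_left (x t : ℝ) : HasDerivAt (fun y : ℝ => (y, t)) ((1 : ℝ), (0 : ℝ)) x :=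
  (hasDerivAt_id x).prodMk (hasDerivAt_const x t)

lemma hasDerivAt_prodMk_right (x t : ℝ) : HasDerivAt (fun s : ℝ => (x, s)) ((0 : ℝ), (1 : ℝ)) t :=
  (hasDerivAt_const t x).prodMk (hasDerivAt_id t)

lemma IsClassicalSolution.exists_jet {p a ε : ℝ} {f g : ℝ → ℝ} {T : ℝ≥0∞} {u : ℝ → ℝ → ℝ}
    (h : IsClassicalSolution p a ε f g T u) {τ : ℝ} (hτ : 0 < τ) (hτT : ENNReal.ofReal τ < T) :
    ∃ v w A B E : ℝ × ℝ → ℝ, IsSolutionJet p a τ u v w A B E := by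
  set U : ℝ × ℝ → ℝ := fun z => u z.1 z.2 with hU
  set S : Set (ℝ × ℝ) := univ ×ˢ Icc 0 τ with hS
  have hlt : ∀ t ∈ Icc 0 τ, ENNReal.ofReal t < T := fun t ht =>
    (ENNReal.ofReal_le_ofReal ht.2).trans_lt hτT
  have hUS : ContDiffOn ℝ 2 U S := h.contDiffOn.mono
    (prod_mono le_rfl fun t ht => ⟨ht.1, hlt t ht⟩)
  have hun : UniqueDiffOn ℝ S := uniqueDiffOn_univ.prod (uniqueDiffOn_Icc hτ)
  set D := fderivWithin ℝ U S with hD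
  have hDc : ContDiffOn ℝ 1 D S := hUS.fderivWithin hun (by norm_num)
  set O : Set (ℝ × ℝ) := univ ×ˢ Ioo 0 τ with hO
  have hOo : IsOpen O := isOpen_univ.prod isOpen_Ioo
  have hOS : O ⊆ S := prod_mono le_rfl Ioo_subset_Icc_self
  have hSn : ∀ z ∈ O, S ∈ nhds z := fun z hz => Filter.mem_of_superset (hOo.mem_nhds hz) hOS
  have hdir : ∀ e : ℝ × ℝ, ContDiffOn ℝ 1 (fun z => D z e) S := fun e =>
    hDc.clm_apply contDiffOn_const
  have hdd : ∀ e : ℝ × ℝ, ∀ z ∈ O, DifferentiableAt ℝ (fun z => D z e) z := fun e z hz =>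
    ((hdir e).contDiffAt (hSn z hz)).differentiableAt (by norm_num)
  have hdc : ∀ e e' : ℝ × ℝ, ContinuousOn (fun z => fderiv ℝ (fun z => D z e) z e') O :=
    fun e e' => ((((hdir e).mono hOS).continuousOn_fderiv_of_isOpen hOo le_rfl).clm_apply
      continuousOn_const)
  have hUat : ∀ z ∈ S, HasFDerivWithinAt U (D z) S z := fun z hz =>
    ((hUS.differentiableOn (by norm_num)) z hz).hasFDerivWithinAt
  have hDeq : ∀ z ∈ O, D =ᶠ[nhds z] fderiv ℝ U := fun z hz => by
    filter_upwards [hOo.mem_nhds hz] with y hy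
    exact fderivWithin_of_mem_nhds (hSn y hy)
  have hsymm : ∀ z ∈ O, ∀ e e' : ℝ × ℝ,
      fderiv ℝ (fun z => D z e) z e' = fderiv ℝ (fun z => D z e') z e := by
    intro z hz e e'
    have hDd : DifferentiableAt ℝ D z :=
      (hDc.contDiffAt (hSn z hz)).differentiableAt (by norm_num)
    have hap : ∀ e : ℝ × ℝ, ∀ e', fderiv ℝ (fun z => D z e) z e' = fderiv ℝ D z e' e := by
      intro e e'
      rw [fderiv_clm_apply hDd (differentiableAt_const e)]
      simp
    rw [hap, hap, (hDeq z hz).fderiv_eq]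
    exact ((hUS.contDiffAt (hSn z hz)).isSymmSndFDerivAt (by simp)) e' e
  have hut : ∀ x, ∀ t ∈ Icc 0 τ,
      HasDerivWithinAt (fun s => u x s) (D (x, t) (0, 1)) (Icc 0 τ) t := by
    intro x t ht
    exact (hUat (x, t) ⟨mem_univ _, ht⟩).comp_hasDerivWithinAt t
      (hasDerivAt_prodMk_right x t).hasDerivWithinAt
      (fun s hs => (⟨mem_univ _, hs⟩ : (x, s) ∈ S))
  have hux : ∀ x, ∀ t ∈ Icc 0 τ, HasDerivAt (fun y => u y t) (D (x, t) (1, 0)) x := by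
    intro x t ht
    have := (hUat (x, t) ⟨mem_univ _, ht⟩).comp_hasDerivWithinAt (s := univ) x
      (hasDerivAt_prodMk_left x t).hasDerivWithinAt
      (fun y _ => (⟨mem_univ _, ht⟩ : (y, t) ∈ S))
    exact hasDerivWithinAt_univ.1 this
  refine ⟨fun z => D z (0, 1), fun z => D z (1, 0),
    fun z => fderiv ℝ (fun z => D z (0, 1)) z (0, 1),
    fun z => fderiv ℝ (fun z => D z (0, 1)) z (1, 0),
    fun z => fderiv ℝ (fun z => D z (1, 0)) z (1, 0),
    hUS.continuousOn, (hdir _).continuousOn, (hdir _).continuousOn, hdc _ _, hdc _ _,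
    hut, hux, ?_, ?_, ?_⟩
  · intro x t ht
    rw [← clm_prod_eq]
    exact (hdd _ (x, t) ⟨mem_univ _, ht⟩).hasFDerivAt
  · intro x t ht
    have hz : (x, t) ∈ O := ⟨mem_univ _, ht⟩
    rw [hsymm _ hz (0, 1) (1, 0), ← clm_prod_eq]
    exact (hdd _ (x, t) hz).hasFDerivAt
  · intro x t ht
    have hz : (x, t) ∈ O := ⟨mem_univ _, ht⟩
    have htc := Ioo_subset_Icc_self ht
    have h1 := h.wave_eq x t ht.1 (hlt t htc)
    rw [iteratedDeriv_succ, iteratedDeriv_one, iteratedDeriv_succ, iteratedDeriv_one] at h1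
    have e1 : deriv (fun s => u x s) =ᶠ[nhds t] fun s => D (x, s) (0, 1) := by
      filter_upwards [Ioo_mem_nhds ht.1 ht.2] with s hs
      exact ((hut x s (Ioo_subset_Icc_self hs)).hasDerivAt (Icc_mem_nhds hs.1 hs.2)).deriv
    have e2 : deriv (fun y => u y t) = fun y => D (y, t) (1, 0) := by
      funext y
      exact (hux y t htc).deriv
    rw [e1.deriv_eq, e2] at h1
    rw [← h1]
    congr 1
    · exact (((hdd (0, 1) (x, t) hz).hasFDerivAt.comp_hasDerivAt t
        (hasDerivAt_prodMk_right x t)).deriv).symm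
    · exact (((hdd (1, 0) (x, t) hz).hasFDerivAt.comp_hasDerivAt x
        (hasDerivAt_prodMk_left x t)).deriv).symm

namespace IsSolutionJet

variable {p a τ : ℝ} {u : ℝ → ℝ → ℝ} {v w A B E : ℝ × ℝ → ℝ}

lemma hasDerivAt_v_t (h : IsSolutionJet p a τ u v w A B E) {x t : ℝ} (ht : t ∈ Ioo 0 τ) :
    HasDerivAt (fun s => v (x, s)) (A (x, t)) t :=
  ((h.fderiv_v x t ht).comp_hasDerivAt t (hasDerivAt_prodMk_right x t)).congr_deriv (by simp)

lemma hasDerivAt_w_x (h : IsSolutionJet p a τ u v w A B E) {x t : ℝ} (ht : t ∈ Ioo 0 τ) :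
    HasDerivAt (fun y => w (y, t)) (E (x, t)) x :=
  ((h.fderiv_w x t ht).comp_hasDerivAt x (hasDerivAt_prodMk_left x t)).congr_deriv (by simp)

lemma hasDerivAt_u_t (h : IsSolutionJet p a τ u v w A B E) {x t : ℝ} (ht : t ∈ Ioo 0 τ) :
    HasDerivAt (fun s => u x s) (v (x, t)) t :=
  (h.deriv_t x t (Ioo_subset_Icc_self ht)).hasDerivAt (Icc_mem_nhds ht.1 ht.2)

/-- `u_t + θ u_x`, `θ = ± 1`, has derivative `u_tt - u_xx` along `x + θ t = const`. -/
lemma hasDerivAt_characteristic (h : IsSolutionJet p a τ u v w A B E) {θ : ℝ} (hθ : θ ^ 2 = 1)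
    (x s : ℝ) {t : ℝ} (ht : t ∈ Ioo 0 τ) :
    HasDerivAt (fun r => v (x + θ * (s - r), r) + θ * w (x + θ * (s - r), r))
      (|w (x + θ * (s - t), t)| ^ p / bracket (x + θ * (s - t)) ^ a) t := by
  have hγ : HasDerivAt (fun r : ℝ => (x + θ * (s - r), r)) (-θ, (1 : ℝ)) t := by
    refine HasDerivAt.prodMk ?_ (hasDerivAt_id t)
    refine ((((hasDerivAt_id t).const_sub s).const_mul θ).const_add x).congr_deriv ?_
    ring
  have h1 := (h.fderiv_v (x + θ * (s - t)) t ht).comp_hasDerivAt_of_eq t hγ rfl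
  have h2 := (h.fderiv_w (x + θ * (s - t)) t ht).comp_hasDerivAt_of_eq t hγ rfl
  refine (h1.add (h2.const_mul θ)).congr_deriv ?_
  rw [← h.wave_eq _ _ ht]
  simp
  linear_combination (-E (x + θ * (s - t), t)) * hθ

/-- Finite speed of propagation for the first derivatives. -/
lemma first_derivs_eq_zero (h : IsSolutionJet p a τ u v w A B E) (hp : 1 < p) {x₀ t₀ : ℝ}
    (ht₀ : t₀ ∈ Icc 0 τ) (h0 : ∀ x, |x - x₀| ≤ t₀ → v (x, 0) = 0 ∧ w (x, 0) = 0) :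
    v (x₀, t₀) = 0 ∧ w (x₀, t₀) = 0 := by
  set Δ : Set (ℝ × ℝ) := {z | 0 ≤ z.2 ∧ |z.1 - x₀| ≤ t₀ - z.2} with hΔ
  have hΔS : Δ ⊆ univ ×ˢ Icc 0 τ := fun z hz =>
    ⟨mem_univ _, hz.1, by linarith [hz.2, abs_nonneg (z.1 - x₀), ht₀.2]⟩
  have hΔc : IsCompact Δ := by
    refine (isCompact_Icc.prod isCompact_Icc :
      IsCompact (Icc (x₀ - t₀) (x₀ + t₀) ×ˢ Icc (0 : ℝ) t₀)).of_isClosed_subset ?_ ?_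
    · have h1 : Continuous fun z : ℝ × ℝ => |z.1 - x₀| := by fun_prop
      have h2 : Continuous fun z : ℝ × ℝ => t₀ - z.2 := by fun_prop
      exact (isClosed_le continuous_const continuous_snd).inter (isClosed_le h1 h2)
    · intro z hz
      have h1 := abs_le.1 hz.2
      have h2 : 0 ≤ z.2 := hz.1
      have h3 := abs_nonneg (z.1 - x₀)
      exact ⟨⟨by linarith [h1.1], by linarith [h1.2]⟩, h2, by linarith [hz.2]⟩
  have htop : (x₀, t₀) ∈ Δ := ⟨ht₀.1, by simp⟩
  have hvc := h.cont_v.mono hΔS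
  have hwc := h.cont_w.mono hΔS
  have hfac : ContinuousOn (fun z : ℝ × ℝ => |w z| ^ (p - 1) / bracket z.1 ^ a) Δ := by
    refine ContinuousOn.div (hwc.abs.rpow_const fun z _ => Or.inr (by linarith))
      ((continuous_bracket_rpow a).comp continuous_fst).continuousOn fun z _ => ?_
    have := bracket_pos z.1
    positivity
  obtain ⟨zK, hzK, hK⟩ := hΔc.exists_isMaxOn ⟨_, htop⟩ hfac
  set K := |w zK| ^ (p - 1) / bracket zK.1 ^ a + 1 with hKdef
  have hK0 : 0 < K := by
    have := bracket_pos zK.1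
    positivity
  have hFle : ∀ z ∈ Δ, |w z| ^ p / bracket z.1 ^ a ≤ K * |w z| := by
    intro z hz
    have hb := bracket_pos z.1
    have h1 : |w z| ^ p = |w z| ^ (p - 1) * |w z| := by
      rw [← Real.rpow_add_one' (abs_nonneg _) (by linarith), sub_add_cancel]
    rw [h1, mul_div_right_comm]
    refine mul_le_mul_of_nonneg_right ?_ (abs_nonneg _)
    linarith [show |w z| ^ (p - 1) / bracket z.1 ^ a ≤ |w zK| ^ (p - 1) / bracket zK.1 ^ a
      from hK hz]
  have hΨ : ContinuousOn
      (fun z : ℝ × ℝ => Real.exp (-(2 * K * z.2)) * (|v z| + |w z|)) Δ :=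
    ContinuousOn.mul (by fun_prop) (hvc.abs.add hwc.abs)
  obtain ⟨zM, hzM, hM⟩ := hΔc.exists_isMaxOn ⟨_, htop⟩ hΨ
  set M := Real.exp (-(2 * K * zM.2)) * (|v zM| + |w zM|) with hMdef
  have hM0 : 0 ≤ M := by positivity
  have hbd : ∀ z ∈ Δ, |v z| + |w z| ≤ M * Real.exp (2 * K * z.2) := by
    intro z hz
    have h1 : Real.exp (-(2 * K * z.2)) * (|v z| + |w z|) ≤ M := hM hz
    rw [Real.exp_neg, inv_mul_le_iff₀ (Real.exp_pos _)] at h1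
    linarith
  have hchar : ∀ θ : ℝ, θ ^ 2 = 1 → ∀ z ∈ Δ,
      |v z + θ * w z| ≤ M / 2 * (Real.exp (2 * K * z.2) - 1) := by
    rintro θ hθ ⟨x, s⟩ hz
    have hs0 : 0 ≤ s := hz.1
    have hθ1 : |θ| = 1 := by
      rcases eq_or_eq_neg_of_sq_eq_sq θ 1 (by rw [hθ, one_pow]) with h | h <;> simp [h]
    have hmem : ∀ r ∈ Icc 0 s, (x + θ * (s - r), r) ∈ Δ := by
      intro r hr
      refine ⟨hr.1, ?_⟩
      have h1 : |x - x₀| ≤ t₀ - s := hz.2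
      have h2 : |θ * (s - r)| = s - r := by
        rw [abs_mul, hθ1, one_mul, abs_of_nonneg (by linarith [hr.2])]
      calc |x + θ * (s - r) - x₀| = |(x - x₀) + θ * (s - r)| := by congr 1; ring
        _ ≤ |x - x₀| + |θ * (s - r)| := abs_add_le _ _
        _ ≤ t₀ - r := by linarith
    have hγc : ContinuousOn (fun r : ℝ => (x + θ * (s - r), r)) (Icc 0 s) := by fun_prop
    set α : ℝ → ℝ := fun r => v (x + θ * (s - r), r) + θ * w (x + θ * (s - r), r) with hα
    have hαc : ContinuousOn α (Icc 0 s) :=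
      (hvc.comp hγc hmem).add (continuousOn_const.mul (hwc.comp hγc hmem))
    have hα0 : α 0 = 0 := by
      have h1 := (hmem 0 ⟨le_rfl, hs0⟩).2
      have h2 := h0 (x + θ * (s - 0)) (by simpa using h1)
      simp only [hα]
      rw [h2.1, h2.2]; simp
    have hst : s ≤ τ := (hΔS hz).2.2
    have hb : ∀ r ∈ Ioo 0 s, |w (x + θ * (s - r), r)| ^ p / bracket (x + θ * (s - r)) ^ a ≤
        M * K * Real.exp (2 * K * r) := by
      intro r hr
      have hm := hmem r (Ioo_subset_Icc_self hr)
      have h1 := hFle _ hm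
      have h2 := hbd _ hm
      simp only at h1 h2
      have h3 := abs_nonneg (v (x + θ * (s - r), r))
      calc _ ≤ K * |w (x + θ * (s - r), r)| := h1
        _ ≤ K * (M * Real.exp (2 * K * r)) := by gcongr; linarith
        _ = _ := by ring
    have hexp : ∀ r : ℝ, HasDerivAt (fun r => M / 2 * (Real.exp (2 * K * r) - 1))
        (M * K * Real.exp (2 * K * r)) r := by
      intro r
      have := ((((hasDerivAt_id r).const_mul (2 * K)).exp.sub_const 1).const_mul (M / 2))
      refine this.congr_deriv ?_
      simp only [id]; ring
    have hd : ∀ r ∈ Ioo 0 s, HasDerivAt α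
        (|w (x + θ * (s - r), r)| ^ p / bracket (x + θ * (s - r)) ^ a) r := fun r hr =>
      h.hasDerivAt_characteristic hθ x s ⟨hr.1, hr.2.trans_le hst⟩
    have hnn : ∀ r, 0 ≤ |w (x + θ * (s - r), r)| ^ p / bracket (x + θ * (s - r)) ^ a := by
      intro r
      have := bracket_pos (x + θ * (s - r))
      positivity
    have hmono1 : MonotoneOn α (Icc 0 s) := by
      refine monotoneOn_of_deriv_nonneg (convex_Icc _ _) hαc (fun r hr => ?_) (fun r hr => ?_)
      · rw [interior_Icc] at hr
        exact (hd r hr).differentiableAt.differentiableWithinAt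
      · rw [interior_Icc] at hr
        rw [(hd r hr).deriv]
        exact hnn r
    have hmono2 : MonotoneOn (fun r => M / 2 * (Real.exp (2 * K * r) - 1) - α r) (Icc 0 s) := by
      refine monotoneOn_of_deriv_nonneg (convex_Icc _ _) (ContinuousOn.sub (by fun_prop) hαc)
        (fun r hr => ?_) (fun r hr => ?_)
      · rw [interior_Icc] at hr
        exact ((hexp r).sub (hd r hr)).differentiableAt.differentiableWithinAt
      · rw [interior_Icc] at hr
        exact (sub_nonneg.2 (hb r hr)).trans_eq ((hexp r).sub (hd r hr)).deriv.symm
    have hl : (0 : ℝ) ∈ Icc 0 s := ⟨le_rfl, hs0⟩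
    have hr : s ∈ Icc 0 s := ⟨hs0, le_rfl⟩
    have h1 := hmono1 hl hr hs0
    have h2 := hmono2 hl hr hs0
    have hαs : α s = v (x, s) + θ * w (x, s) := by simp [hα]
    simp only [hα0, mul_zero, Real.exp_zero, sub_self] at h2
    rw [hα0, hαs] at h1
    rw [hαs] at h2
    rw [abs_of_nonneg h1]
    linarith
  have hMz : M ≤ 0 := by
    have h1 := hchar 1 (by norm_num) zM hzM
    have h2 := hchar (-1) (by norm_num) zM hzM
    have h3 : |v zM| + |w zM| ≤ M * (Real.exp (2 * K * zM.2) - 1) := by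
      have e1 := abs_le.1 h1
      have e2 := abs_le.1 h2
      rcases abs_cases (v zM) with h | h <;> rcases abs_cases (w zM) with h' | h' <;>
        rw [h.1, h'.1] <;> linarith [e1.1, e1.2, e2.1, e2.2]
    have h4 : M * Real.exp (2 * K * zM.2) = |v zM| + |w zM| := by
      rw [hMdef, Real.exp_neg]
      field_simp
    linarith
  have h1 := hbd _ htop
  have h2 : |v (x₀, t₀)| + |w (x₀, t₀)| ≤ 0 :=
    h1.trans (mul_nonpos_of_nonpos_of_nonneg hMz (Real.exp_pos _).le)
  exact ⟨abs_eq_zero.1 (le_antisymm (by linarith [abs_nonneg (w (x₀, t₀))]) (abs_nonneg _)),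
    abs_eq_zero.1 (le_antisymm (by linarith [abs_nonneg (v (x₀, t₀))]) (abs_nonneg _))⟩

end IsSolutionJet

lemma continuous_slice {φ : ℝ × ℝ → ℝ} {I : Set ℝ} (hφ : ContinuousOn φ (univ ×ˢ I)) {t : ℝ}
    (ht : t ∈ I) : Continuous fun x => φ (x, t) :=
  hφ.comp_continuous (by fun_prop) fun _ => ⟨mem_univ _, ht⟩

lemma hasDerivAt_integral_slice {φ ψ : ℝ × ℝ → ℝ} {τ : ℝ} (M : ℝ)
    (hφ : ContinuousOn φ (univ ×ˢ Ioo 0 τ)) (hψ : ContinuousOn ψ (univ ×ˢ Ioo 0 τ))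
    (hd : ∀ x, ∀ t ∈ Ioo 0 τ, HasDerivAt (fun s => φ (x, s)) (ψ (x, t)) t)
    {t : ℝ} (ht : t ∈ Ioo 0 τ) :
    HasDerivAt (fun s => ∫ x in -M..M, φ (x, s)) (∫ x in -M..M, ψ (x, t)) t := by
  obtain ⟨δ, hδ, hball⟩ := Metric.nhds_basis_closedBall.mem_iff.1 (Ioo_mem_nhds ht.1 ht.2)
  have hK : IsCompact (uIcc (-M) M ×ˢ Metric.closedBall t δ) :=
    isCompact_uIcc.prod (isCompact_closedBall t δ)
  obtain ⟨b, hb⟩ := hK.exists_bound_of_continuousOn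
    (hψ.mono (prod_mono (subset_univ _) hball))
  refine (intervalIntegral.hasDerivAt_integral_of_dominated_loc_of_deriv_le
    (F := fun s x => φ (x, s)) (F' := fun s x => ψ (x, s)) (bound := fun _ => b)
    (Metric.closedBall_mem_nhds t hδ) ?_ ?_ ?_ ?_ ?_ ?_).2
  · filter_upwards [Ioo_mem_nhds ht.1 ht.2] with s hs
    exact (continuous_slice hφ hs).aestronglyMeasurable
  · exact (continuous_slice hφ ht).intervalIntegrable _ _
  · exact (continuous_slice hψ ht).aestronglyMeasurable
  · exact Filter.Eventually.of_forall fun x hx s hs => hb (x, s) ⟨uIoc_subset_uIcc hx, hs⟩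
  · exact intervalIntegrable_const
  · exact Filter.Eventually.of_forall fun x _ s hs => hd x s (hball hs)

lemma continuousOn_integral_slice {φ : ℝ × ℝ → ℝ} {τ : ℝ} (hτ : 0 ≤ τ) (M : ℝ)
    (hφ : ContinuousOn φ (univ ×ˢ Icc 0 τ)) :
    ContinuousOn (fun t => ∫ x in -M..M, φ (x, t)) (Icc 0 τ) := by
  have hc : Continuous (Function.uncurry fun (t x : ℝ) => φ (x, (projIcc 0 τ hτ t : ℝ))) := by
    refine hφ.comp_continuous (f := fun z : ℝ × ℝ => (z.2, (projIcc 0 τ hτ z.1 : ℝ))) ?_ ?_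
    · exact continuous_snd.prodMk
        (continuous_subtype_val.comp (continuous_projIcc.comp continuous_fst))
    · exact fun z => ⟨mem_univ _, (projIcc 0 τ hτ z.1).2⟩
  refine (intervalIntegral.continuous_parametric_intervalIntegral_of_continuous' (μ := volume)
    hc (-M) M).continuousOn.congr fun t ht => ?_
  simp only [projIcc_of_mem hτ ht]

lemma integral_eq_of_eq_zero {φ : ℝ → ℝ} {r ρ M : ℝ} (h : ∀ x, r < |x| → φ x = 0) (hρ : r < ρ)
    (hM : r < M) : ∫ x in -M..M, φ x = ∫ x in -ρ..ρ, φ x := by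
  have hs : ∀ L, r < L → Function.support φ ⊆ Ioc (-L) L := by
    intro L hL x hx
    have h1 : |x| ≤ r := not_lt.1 fun hlt => hx (h x hlt)
    have h2 := abs_le.1 h1
    exact ⟨by linarith [h2.1], by linarith [h2.2]⟩
  rw [intervalIntegral.integral_eq_integral_of_support_subset (hs M hM),
    intervalIntegral.integral_eq_integral_of_support_subset (hs ρ hρ)]

lemma integral_exp_add_exp_neg_mul {φ φ' : ℝ → ℝ} {M : ℝ} (hd : ∀ x, HasDerivAt φ (φ' x) x)
    (hc : Continuous φ') (h1 : φ M = 0) (h2 : φ (-M) = 0) :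
    ∫ x in -M..M, (Real.exp x + Real.exp (-x)) * φ x =
      ∫ x in -M..M, (-Real.exp x + Real.exp (-x)) * φ' x := by
  have hk : ∀ x : ℝ, HasDerivAt (fun x => -Real.exp x + Real.exp (-x))
      (-(Real.exp x + Real.exp (-x))) x := by
    intro x
    refine ((Real.hasDerivAt_exp x).neg.add (hasDerivAt_neg x).exp).congr_deriv ?_
    ring
  rw [intervalIntegral.integral_mul_deriv_eq_deriv_mul (fun x _ => hk x) (fun x _ => hd x)
    (Continuous.intervalIntegrable (by fun_prop) _ _) (hc.intervalIntegrable _ _), h1, h2]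
  simp [-neg_add_rev]

lemma integral_exp_add_exp_neg_mul_deriv {φ φ' : ℝ → ℝ} {M : ℝ}
    (hd : ∀ x, HasDerivAt φ (φ' x) x) (hc : Continuous φ') (h1 : φ M = 0) (h2 : φ (-M) = 0) :
    ∫ x in -M..M, (Real.exp x + Real.exp (-x)) * φ' x =
      ∫ x in -M..M, (-Real.exp x + Real.exp (-x)) * φ x := by
  have hk : ∀ x : ℝ, HasDerivAt (fun x => Real.exp x + Real.exp (-x))
      (-(-Real.exp x + Real.exp (-x))) x := by
    intro x
    refine ((Real.hasDerivAt_exp x).add (hasDerivAt_neg x).exp).congr_deriv ?_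
    ring
  rw [intervalIntegral.integral_mul_deriv_eq_deriv_mul (fun x _ => hk x) (fun x _ => hd x)
    (Continuous.intervalIntegrable (by fun_prop) _ _) (hc.intervalIntegrable _ _), h1, h2]
  simp [-neg_add_rev]

namespace IsSolutionJet

variable {p a τ R : ℝ} {u : ℝ → ℝ → ℝ} {v w A B E : ℝ × ℝ → ℝ}

/-- Finite speed of propagation. -/
lemma eq_zero_of_lt_abs (h : IsSolutionJet p a τ u v w A B E) (hp : 1 < p)
    (h0 : ∀ x, R < |x| → u x 0 = 0 ∧ v (x, 0) = 0 ∧ w (x, 0) = 0) {x t : ℝ} (ht : t ∈ Icc 0 τ)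
    (hx : R + t < |x|) : u x t = 0 ∧ w (x, t) = 0 ∧ v (x, t) = 0 := by
  have hvw : ∀ s ∈ Icc 0 t, v (x, s) = 0 ∧ w (x, s) = 0 := by
    intro s hs
    refine h.first_derivs_eq_zero hp ⟨hs.1, hs.2.trans ht.2⟩ fun y hy => (h0 y ?_).2
    have h1 : |x| ≤ |y| + |y - x| := by
      have := abs_sub_abs_le_abs_sub x y
      rw [abs_sub_comm] at this
      linarith
    linarith [hs.2]
  have hu : ‖u x t - u x 0‖ ≤ 0 * ‖t - 0‖ := by
    refine (convex_Icc 0 t).norm_image_sub_le_of_norm_hasDerivWithin_le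
      (f := fun s => u x s) (f' := fun s => v (x, s)) (fun s hs => ?_) (fun s hs => ?_)
      (left_mem_Icc.2 ht.1) (right_mem_Icc.2 ht.1)
    · exact (h.deriv_t x s ⟨hs.1, hs.2.trans ht.2⟩).mono (Icc_subset_Icc_right ht.2)
    · rw [(hvw s hs).1, norm_zero]
  rw [zero_mul, norm_le_zero_iff, (h0 x (by linarith [ht.1])).1, sub_zero] at hu
  have h1 := hvw t (right_mem_Icc.2 ht.1)
  exact ⟨hu, h1.2, h1.1⟩

lemma hasDerivAt_functional (h : IsSolutionJet p a τ u v w A B E) (M : ℝ) {t : ℝ}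
    (ht : t ∈ Ioo 0 τ) :
    HasDerivAt (fun t => ∫ x in -M..M, (Real.exp x + Real.exp (-x)) * u x t)
      (∫ x in -M..M, (Real.exp x + Real.exp (-x)) * v (x, t)) t := by
  have hs : (univ : Set ℝ) ×ˢ Ioo 0 τ ⊆ univ ×ˢ Icc 0 τ := prod_mono le_rfl Ioo_subset_Icc_self
  have hc : ContinuousOn (fun z : ℝ × ℝ => Real.exp z.1 + Real.exp (-z.1)) (univ ×ˢ Ioo 0 τ) := by
    fun_prop
  exact hasDerivAt_integral_slice M (hc.mul (h.cont_u.mono hs)) (hc.mul (h.cont_v.mono hs))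
    (fun x s hs => (h.hasDerivAt_u_t hs).const_mul (Real.exp x + Real.exp (-x))) ht

lemma hasDerivAt_functional_v (h : IsSolutionJet p a τ u v w A B E) (hp : 1 < p) {M t : ℝ}
    (ht : t ∈ Ioo 0 τ) (hM : u M t = 0 ∧ w (M, t) = 0) (hM' : u (-M) t = 0 ∧ w (-M, t) = 0) :
    HasDerivAt (fun t => ∫ x in -M..M, (Real.exp x + Real.exp (-x)) * v (x, t))
      ((∫ x in -M..M, (Real.exp x + Real.exp (-x)) * u x t) +
        ∫ x in -M..M, |w (x, t)| ^ p / bracket x ^ a * (Real.exp x + Real.exp (-x))) t := by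
  have hs : (univ : Set ℝ) ×ˢ Ioo 0 τ ⊆ univ ×ˢ Icc 0 τ := prod_mono le_rfl Ioo_subset_Icc_self
  have hc : ContinuousOn (fun z : ℝ × ℝ => Real.exp z.1 + Real.exp (-z.1)) (univ ×ˢ Ioo 0 τ) := by
    fun_prop
  have ht' := Ioo_subset_Icc_self ht
  have hw := continuous_slice h.cont_w ht'
  have hE := continuous_slice h.cont_E ht
  have hh : Continuous fun x => Real.exp x + Real.exp (-x) := by fun_prop
  have hF : Continuous fun x => |w (x, t)| ^ p / bracket x ^ a := by
    refine Continuous.div (hw.abs.rpow_const fun x => Or.inr (by linarith))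
      (continuous_bracket_rpow a) fun x => ?_
    have := bracket_pos x
    positivity
  have hhE : IntervalIntegrable (fun x => (Real.exp x + Real.exp (-x)) * E (x, t)) volume (-M) M :=
    (hh.mul hE).intervalIntegrable _ _
  have hFh : IntervalIntegrable (fun x => |w (x, t)| ^ p / bracket x ^ a *
      (Real.exp x + Real.exp (-x))) volume (-M) M := (hF.mul hh).intervalIntegrable _ _
  refine (hasDerivAt_integral_slice M (hc.mul (h.cont_v.mono hs)) (hc.mul h.cont_A)
    (fun x s hs => (h.hasDerivAt_v_t hs).const_mul (Real.exp x + Real.exp (-x))) ht).congr_deriv ?_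
  rw [integral_exp_add_exp_neg_mul (fun x => h.deriv_x x t ht') hw hM.1 hM'.1,
    ← integral_exp_add_exp_neg_mul_deriv (fun x => h.hasDerivAt_w_x ht) hE hM.2 hM'.2,
    ← intervalIntegral.integral_add hhE hFh]
  refine intervalIntegral.integral_congr fun x _ => ?_
  simp only [Pi.mul_apply]
  rw [← h.wave_eq x t ht]
  ring

end IsSolutionJet

lemma rpow_neg_le_bracket_rpow_neg (a : ℝ) {R t : ℝ} (hR : 1 ≤ R) (ht : 1 ≤ t) :
    (R + 3) ^ (-|a|) * t ^ (-a) ≤ bracket (R + t + 1) ^ (-a) := by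
  have hb := le_bracket (R + t + 1)
  have hb' := bracket_le_one_add (show 0 ≤ R + t + 1 by linarith)
  have ht0 : 0 < t := by linarith
  rcases le_total 0 a with h | h
  · rw [abs_of_nonneg h, ← Real.mul_rpow (by linarith) ht0.le]
    exact Real.rpow_le_rpow_of_nonpos (bracket_pos _) (by nlinarith) (by linarith)
  · have h1 : (R + 3) ^ (-|a|) ≤ 1 :=
      Real.rpow_le_one_of_one_le_of_nonpos (by linarith) (by simp)
    have h2 : t ^ (-a) ≤ bracket (R + t + 1) ^ (-a) :=
      Real.rpow_le_rpow ht0.le (by linarith) (by linarith)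
    have h3 : 0 ≤ t ^ (-a) := by positivity
    nlinarith

lemma lifespanBound_nonneg {p a C ε : ℝ} (hC : 0 < C) (hε : 0 < ε) :
    0 ≤ lifespanBound p a C ε := by
  unfold lifespanBound
  split_ifs <;> positivity

lemma IsClassicalSolution.jet_init {p a ε : ℝ} {f g : ℝ → ℝ} {T : ℝ≥0∞} {u : ℝ → ℝ → ℝ}
    (h : IsClassicalSolution p a ε f g T u) (hf : Differentiable ℝ f) {τ : ℝ} (hτ : 0 < τ)
    {v w A B E : ℝ × ℝ → ℝ} (hj : IsSolutionJet p a τ u v w A B E) (x : ℝ) :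
    v (x, 0) = ε * g x ∧ w (x, 0) = ε * deriv f x := by
  have h0 : (0 : ℝ) ∈ Icc 0 τ := ⟨le_rfl, hτ.le⟩
  constructor
  · exact (uniqueDiffOn_Icc hτ 0 h0).eq_deriv _ (hj.deriv_t x 0 h0)
      ((h.init_vel x).mono Icc_subset_Ici_self)
  · have h1 := hj.deriv_x x 0 h0
    rw [show (fun y => u y 0) = fun y => ε * f y from funext h.init_pos] at h1
    exact h1.unique ((hf x).hasDerivAt.const_mul ε)

lemma eq_zero_of_tsupport_subset {f : ℝ → ℝ} {R x : ℝ} (hf : tsupport f ⊆ {x : ℝ | |x| ≤ R})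
    (hx : R < |x|) : f x = 0 ∧ deriv f x = 0 := by
  have hn : x ∉ tsupport f := fun h => absurd (hf h) (not_le.2 hx)
  refine ⟨image_eq_zero_of_notMem_tsupport hn, ?_⟩
  by_contra h
  exact hn (support_deriv_subset h)

/-- The integrals over the line of compactly supported functions, as interval integrals. -/
lemma integral_eq_intervalIntegral {φ : ℝ → ℝ} {R M : ℝ} (h : ∀ x, R < |x| → φ x = 0)
    (hM : R < M) : ∫ x, φ x = ∫ x in -M..M, φ x := by
  refine (intervalIntegral.integral_eq_integral_of_support_subset fun x hx => ?_).symm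
  have h1 : |x| ≤ R := not_lt.1 fun hlt => hx (h x hlt)
  have h2 := abs_le.1 h1
  exact ⟨by linarith [h2.1], by linarith [h2.2]⟩

lemma exists_functional_of_solution {p a R : ℝ} (hp : 1 < p) (hR : 1 ≤ R)
    {f g : ℝ → ℝ} (hf : ContDiff ℝ 2 f) (hg : ContDiff ℝ 1 g)
    (hfR : tsupport f ⊆ {x : ℝ | |x| ≤ R}) (hgR : tsupport g ⊆ {x : ℝ | |x| ≤ R})
    (h₁ : 0 ≤ ∫ x : ℝ, (-Real.exp x + Real.exp (-x)) * deriv f x) :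
    ∃ c : ℝ, 0 < c ∧ ∀ (ε τ : ℝ) (T : ℝ≥0∞) (u : ℝ → ℝ → ℝ), 0 < ε → 0 < τ →
      ENNReal.ofReal τ < T → IsClassicalSolution p a ε f g T u →
      ∃ G W W' : ℝ → ℝ, ContinuousOn G (Ico 0 τ) ∧ ContinuousOn W (Ico 0 τ) ∧
        (∀ t ∈ Ioo 0 τ, HasDerivAt G (W t - 2 * G t) t) ∧
        (∀ t ∈ Ioo 0 τ, HasDerivAt W (W' t) t) ∧
        (∀ t ∈ Ioo 0 τ, 0 ≤ W' t) ∧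
        (∀ t ∈ Ioo 0 τ, 1 ≤ t → c * t ^ (-a) * |G t| ^ p ≤ W' t) ∧
        0 ≤ G 0 ∧
        ε * (∫ x : ℝ, (-Real.exp x + Real.exp (-x)) * (deriv g x - deriv f x)) ≤ W 0 := by
  obtain ⟨c, hc, hcb⟩ := exists_weighted_lower_bound a hp
  refine ⟨c * Real.exp (-(p - 1) * (R + 1)) * (R + 3) ^ (-|a|), by positivity, ?_⟩
  intro ε τ T u hε hτ hτT hu
  obtain ⟨v, w, A, B, E, hj⟩ := hu.exists_jet hτ hτT
  have hfd : Differentiable ℝ f := hf.differentiable (by norm_num)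
  have hgd : Differentiable ℝ g := hg.differentiable (by norm_num)
  have hf'c : Continuous (deriv f) := hf.continuous_deriv (by norm_num)
  have hg'c : Continuous (deriv g) := hg.continuous_deriv le_rfl
  have hinit := hu.jet_init hfd hτ hj
  have hzero : ∀ t ∈ Icc 0 τ, ∀ x, R + t < |x| → u x t = 0 ∧ w (x, t) = 0 ∧ v (x, t) = 0 :=
    fun t ht x hx => hj.eq_zero_of_lt_abs hp (fun y hy => by
      rw [hu.init_pos, (hinit y).1, (hinit y).2, (eq_zero_of_tsupport_subset hfR hy).1,
        (eq_zero_of_tsupport_subset hgR hy).1, (eq_zero_of_tsupport_subset hfR hy).2]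
      simp) ht hx
  obtain ⟨M, hM⟩ : ∃ M, M = R + τ + 1 := ⟨_, rfl⟩
  have hMabs : |M| = M := abs_of_nonneg (by linarith)
  have hMz : ∀ t ∈ Icc 0 τ, R + t < M := fun t ht => by linarith [ht.2]
  set H : ℝ → ℝ := fun t => ∫ x in -M..M, (Real.exp x + Real.exp (-x)) * u x t with hH
  set V : ℝ → ℝ := fun t => ∫ x in -M..M, (Real.exp x + Real.exp (-x)) * v (x, t) with hV
  set N : ℝ → ℝ := fun t => ∫ x in -M..M,
    |w (x, t)| ^ p / bracket x ^ a * (Real.exp x + Real.exp (-x)) with hN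
  have hHd : ∀ t ∈ Ioo 0 τ, HasDerivAt H (V t) t := fun t ht => hj.hasDerivAt_functional M ht
  have hVd : ∀ t ∈ Ioo 0 τ, HasDerivAt V (H t + N t) t := fun t ht => by
    have ht' := Ioo_subset_Icc_self ht
    have e1 := hzero t ht' M (by rw [hMabs]; exact hMz t ht')
    have e2 := hzero t ht' (-M) (by rw [abs_neg, hMabs]; exact hMz t ht')
    exact hj.hasDerivAt_functional_v hp ht ⟨e1.1, e1.2.1⟩ ⟨e2.1, e2.2.1⟩
  have hwc : ContinuousOn (fun z : ℝ × ℝ => Real.exp z.1 + Real.exp (-z.1)) (univ ×ˢ Icc 0 τ) := by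
    fun_prop
  have hHc : ContinuousOn H (Ico 0 τ) :=
    (continuousOn_integral_slice hτ.le M (hwc.mul hj.cont_u)).mono Ico_subset_Icc_self
  have hVc : ContinuousOn V (Ico 0 τ) :=
    (continuousOn_integral_slice hτ.le M (hwc.mul hj.cont_v)).mono Ico_subset_Icc_self
  have hed : ∀ t : ℝ, HasDerivAt (fun t => Real.exp (-t)) (-Real.exp (-t)) t := fun t => by
    simpa using (hasDerivAt_neg t).exp
  have hN0 : ∀ t, 0 ≤ N t := fun t => by
    refine intervalIntegral.integral_nonneg (by linarith) fun x _ => ?_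
    have := bracket_pos x
    positivity
  have h0 : (0 : ℝ) ∈ Icc 0 τ := ⟨le_rfl, hτ.le⟩
  have hRM : R < M := by linarith
  have hHw : ∀ t ∈ Icc 0 τ, H t = ∫ x in -M..M, (-Real.exp x + Real.exp (-x)) * w (x, t) := by
    intro t ht
    exact integral_exp_add_exp_neg_mul (fun x => hj.deriv_x x t ht)
      (continuous_slice hj.cont_w ht)
      (hzero t ht M (by rw [hMabs]; exact hMz t ht)).1
      (hzero t ht (-M) (by rw [abs_neg, hMabs]; exact hMz t ht)).1
  have hJf : ∫ x : ℝ, (-Real.exp x + Real.exp (-x)) * deriv f x =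
      ∫ x in -M..M, (-Real.exp x + Real.exp (-x)) * deriv f x :=
    integral_eq_intervalIntegral
      (fun x hx => by rw [(eq_zero_of_tsupport_subset hfR hx).2, mul_zero]) hRM
  have hJg : ∫ x : ℝ, (-Real.exp x + Real.exp (-x)) * (deriv g x - deriv f x) =
      (∫ x in -M..M, (-Real.exp x + Real.exp (-x)) * deriv g x) -
      ∫ x in -M..M, (-Real.exp x + Real.exp (-x)) * deriv f x := by
    rw [integral_eq_intervalIntegral (fun x hx => by
      rw [(eq_zero_of_tsupport_subset hfR hx).2, (eq_zero_of_tsupport_subset hgR hx).2, sub_zero,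
        mul_zero]) hRM,
      ← intervalIntegral.integral_sub (Continuous.intervalIntegrable (by fun_prop) _ _)
        (Continuous.intervalIntegrable (by fun_prop) _ _)]
    simp only [mul_sub]
  have hH0 : H 0 = ε * ∫ x : ℝ, (-Real.exp x + Real.exp (-x)) * deriv f x := by
    rw [hHw 0 h0, hJf, ← intervalIntegral.integral_const_mul]
    refine intervalIntegral.integral_congr fun x _ => ?_
    simp only [(hinit x).2]; ring
  have hV0 : V 0 = ε * ∫ x in -M..M, (-Real.exp x + Real.exp (-x)) * deriv g x := by
    rw [← integral_exp_add_exp_neg_mul (fun x => (hgd x).hasDerivAt) hg'c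
      (eq_zero_of_tsupport_subset hgR (by rwa [hMabs])).1
      (eq_zero_of_tsupport_subset hgR (by rwa [abs_neg, hMabs])).1,
      ← intervalIntegral.integral_const_mul]
    refine intervalIntegral.integral_congr fun x _ => ?_
    simp only [(hinit x).1]; ring
  refine ⟨fun t => Real.exp (-t) * H t, fun t => Real.exp (-t) * (H t + V t),
    fun t => Real.exp (-t) * N t, ContinuousOn.mul (by fun_prop) hHc,
    ContinuousOn.mul (by fun_prop) (hHc.add hVc), ?_, ?_, ?_, ?_, ?_, ?_⟩
  · intro t ht
    refine ((hed t).mul (hHd t ht)).congr_deriv ?_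
    ring
  · intro t ht
    refine ((hed t).mul ((hHd t ht).add (hVd t ht))).congr_deriv ?_
    simp only [Pi.add_apply]; ring
  · intro t _
    exact mul_nonneg (Real.exp_pos _).le (hN0 t)
  · intro t ht ht1
    have ht' := Ioo_subset_Icc_self ht
    obtain ⟨ρ, hρ⟩ : ∃ ρ, ρ = R + t + 1 := ⟨_, rfl⟩
    have hb := hcb ρ (by linarith) _ (continuous_slice hj.cont_w ht')
    rw [← integral_eq_of_eq_zero (r := R + t) (ρ := ρ) (M := M)
      (fun x hx => by rw [(hzero t ht' x hx).2.1, mul_zero]) (by linarith) (hMz t ht'),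
      ← hHw t ht', ← integral_eq_of_eq_zero (r := R + t) (ρ := ρ) (M := M)
      (fun x hx => by
        rw [(hzero t ht' x hx).2.1, abs_zero, Real.zero_rpow (by linarith), zero_div, zero_mul])
      (by linarith) (hMz t ht')] at hb
    have hbr := rpow_neg_le_bracket_rpow_neg a hR ht1
    rw [← hρ] at hbr
    have hGp : |Real.exp (-t) * H t| ^ p = Real.exp (-t * p) * |H t| ^ p := by
      rw [abs_mul, abs_of_pos (Real.exp_pos _), Real.mul_rpow (Real.exp_pos _).le (abs_nonneg _),
        ← Real.exp_mul]
    have hexp : Real.exp (-(p - 1) * (R + 1)) * Real.exp (-t * p) =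
        Real.exp (-t) * Real.exp (-(p - 1) * ρ) := by
      rw [← Real.exp_add, ← Real.exp_add, hρ]
      congr 1; ring
    simp only
    rw [hGp]
    calc c * Real.exp (-(p - 1) * (R + 1)) * (R + 3) ^ (-|a|) * t ^ (-a) *
          (Real.exp (-t * p) * |H t| ^ p)
        = c * ((R + 3) ^ (-|a|) * t ^ (-a)) *
          (Real.exp (-(p - 1) * (R + 1)) * Real.exp (-t * p)) * |H t| ^ p := by ring
      _ ≤ c * bracket ρ ^ (-a) *
          (Real.exp (-(p - 1) * (R + 1)) * Real.exp (-t * p)) * |H t| ^ p := by gcongr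
      _ = Real.exp (-t) * (c * bracket ρ ^ (-a) * Real.exp (-(p - 1) * ρ) * |H t| ^ p) := by
          rw [hexp]; ring
      _ ≤ Real.exp (-t) * N t := by gcongr
  · simp only [neg_zero, Real.exp_zero, one_mul, hH0]
    positivity
  · simp only [neg_zero, Real.exp_zero, one_mul, hH0, hV0, hJg, hJf]
    have : 0 ≤ ε * ∫ x in -M..M, (-Real.exp x + Real.exp (-x)) * deriv f x := by
      rw [← hJf]; positivity
    linarith

end SpatialDerivWave

theorem theorem2p2 (p a R : ℝ) (hp : 1 < p) (ha : a ≤ 1) (hR : 1 ≤ R)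
    (f g : ℝ → ℝ) (hf : ContDiff ℝ 2 f) (hg : ContDiff ℝ 1 g)
    (hfR : tsupport f ⊆ {x : ℝ | |x| ≤ R}) (hgR : tsupport g ⊆ {x : ℝ | |x| ≤ R})
    (h₁ : 0 ≤ ∫ x : ℝ, (-Real.exp x + Real.exp (-x)) * deriv f x)
    (h₂ : 0 ≤ ∫ x : ℝ, (-Real.exp x + Real.exp (-x)) * (deriv g x - deriv f x))
    (h₂' : ∫ x : ℝ, (-Real.exp x + Real.exp (-x)) * (deriv g x - deriv f x) ≠ 0) :
    ∃ ε₁ : ℝ, 0 < ε₁ ∧ ∃ C : ℝ, 0 < C ∧ ∀ ε : ℝ, 0 < ε → ε ≤ ε₁ →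
      (∀ T : ℝ≥0∞, ENNReal.ofReal (SpatialDerivWave.lifespanBound p a C ε) < T →
        ¬ ∃ u : ℝ → ℝ → ℝ, SpatialDerivWave.IsClassicalSolution p a ε f g T u) ∧
      SpatialDerivWave.lifespan p a ε f g ≤
        ENNReal.ofReal (SpatialDerivWave.lifespanBound p a C ε) := by
  obtain ⟨c, hc, hfun⟩ :=
    SpatialDerivWave.exists_functional_of_solution (a := a) hp hR hf hg hfR hgR h₁
  obtain ⟨C, hC, hode⟩ :=
    SpatialDerivWave.exists_lifespanBound_of_functional hp ha hc (h₂.lt_of_ne' h₂')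
  refine ⟨1, one_pos, C, hC, fun ε hε hε1 => ?_⟩
  have hno : ∀ T : ℝ≥0∞, ENNReal.ofReal (SpatialDerivWave.lifespanBound p a C ε) < T →
      ¬ ∃ u : ℝ → ℝ → ℝ, SpatialDerivWave.IsClassicalSolution p a ε f g T u := by
    rintro T hT ⟨u, hu⟩
    obtain ⟨q, hq, hqT⟩ := exists_between hT
    have hqtop : q ≠ ⊤ := hqT.ne_top
    have hb0 := SpatialDerivWave.lifespanBound_nonneg (p := p) (a := a) hC hε
    have hlt : SpatialDerivWave.lifespanBound p a C ε < q.toReal :=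
      (ENNReal.ofReal_lt_iff_lt_toReal hb0 hqtop).1 hq
    obtain ⟨G, W, W', hGc, hWc, hG, hW, hW0, hW', hG0, hWi⟩ :=
      hfun ε q.toReal T u hε (hb0.trans_lt hlt) (by rwa [ENNReal.ofReal_toReal hqtop]) hu
    exact hode ε hε hε1 q.toReal hlt G W W' hGc hWc hG hW hW0 hW' hG0 hWi
  refine ⟨hno, sSup_le fun T hT => ?_⟩
  by_contra hlt
  exact hno T (not_le.1 hlt) hT
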